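/- Let $\Gamma$ be an $n$-dimensional crystallographic group ($n$-space group), i.e. a discrete group of isometries $b+B : x\mapsto b+Bx$ ($b\in E^n$, $B\in \mathrm{O}(n)$) of Euclidean $n$-space $E^n$ with compact orbit space $E^n/\Gamma$. Let $N$ be a normal subgroup of $\Gamma$ such that $\Gamma/N$ is an infinite dihedral group. Let $V=\mathrm{Span}(N)$ be the linear span of all $a\in E^n$ such that the translation $x\mapsto a+x$ belongs to $N$, and let $V^\perp$ be its orthogonal complement. An element $b+B$ of $\Gamma$ acts on $V$ by $v\mapsto \overline b+Bv$ and on $V^\perp$ by $w\mapsto b'+Bw$, where $\overline b$ and $b'$ are the orthogonal projections of $b$ to $V$ and to $V^\perp$. Let $K$ be the kernel of the action of $\Gamma$ on $V$; it is a normal subgroup of $\Gamma$, and $\Gamma/NK$ acts on the orbit space $V^\perp/K$ by $((b+B)NK)(Kw)=K(b'+Bw)$, where $V^\perp/K$ carries the orbit space metric. Suppose that the structure group $\Gamma/NK$ is finite. Let $\gamma_1$ and $\gamma_2$ be elements of $\Gamma$ such that $\{\gamma_1NK,\gamma_2NK\}$ generates $\Gamma/NK$. Then there exist elements $\delta_1$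 and $\delta_2$ of $\Gamma$ such that $\{\gamma_1NK,\gamma_2NK\}=\{\delta_1NK,\delta_2NK\}$ and $\{\delta_1N,\delta_2N\}$ is a set of Coxeter generators of $\Gamma/N$ (that is, $\delta_1N$ and $\delta_2N$ have order $2$ and generate $\Gamma/N$) if and only if one of the following holds: (1) The order of $\Gamma/NK$ is $1$. (2) The order of $\Gamma/NK$ is $2$, the group $K$ is infinite dihedral, one of $\gamma_1NK$, $\gamma_2NK$ is the identity element of $\Gamma/NK$, and the other acts as the reflection of the closed interval $V^\perp/K$ (in its midpoint). (3) The order of $\Gamma/NK$ is $2m$ for some positive integer $m$, the group $K$ is infinite cyclic, both $\gamma_1NK$ and $\gamma_2NK$ act as reflections of the circle $V^\perp/K$, and $\gamma_1\gamma_2NK$ acts on $V^\perp/K$ as a rotation of $2\pi/m$ or $-2\pi/m$. -/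

import Mathlib

noncomputable section

namespace FlatFibration

/-! ### Orbit spaces -/

section Orbits

variable {G X : Type*} [Group G]

/-- The relation on `X` whose classes are the orbits of the subgroup `H` of `G`, where `G` acts
on `X` through `ρ`. -/
def orbitSetoid (ρ : G →* Equiv.Perm X) (H : Subgroup G) : Setoid X where
  r x y := ∃ h ∈ H, ρ h x = y
  iseqv :=
    { refl := fun x => ⟨1, H.one_mem, by simp⟩
      symm := by
        rintro x y ⟨h, hh, rfl⟩
        exact ⟨h⁻¹, H.inv_mem hh, by simp⟩
      trans := by
        rintro x y z ⟨h, hh, rfl⟩ ⟨k, hk, rfl⟩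
        exact ⟨k * h, H.mul_mem hk hh, by simp⟩ }

/-- The orbit space `X/H`. -/
abbrev OrbitSpace (ρ : G →* Equiv.Perm X) (H : Subgroup G) : Type _ :=
  Quotient (orbitSetoid ρ H)

/-- The orbit space distance: the distance between two orbits as subsets of `X`. -/
instance OrbitSpace.instDist [Dist X] (ρ : G →* Equiv.Perm X) (H : Subgroup G) :
    Dist (OrbitSpace ρ H) where
  dist p q := sInf {r : ℝ | ∃ x y : X,
    Quotient.mk (orbitSetoid ρ H) x = p ∧ Quotient.mk (orbitSetoid ρ H) y = q ∧ r = dist x y}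

/-- For a normal subgroup `H`, the self-map `Hx ↦ H(gx)` of `X/H` induced by `g`. -/
def OrbitSpace.map (ρ : G →* Equiv.Perm X) (H : Subgroup G) [hH : H.Normal] (g : G) :
    OrbitSpace ρ H → OrbitSpace ρ H :=
  Quotient.map (sa := orbitSetoid ρ H) (sb := orbitSetoid ρ H) (ρ g) (by
    rintro x y ⟨h, hh, rfl⟩
    exact ⟨g * h * g⁻¹, hH.conj_mem h hh g, by simp⟩)

end Orbits

/-! ### Reflections and rotations of closed intervals and circles -/

section Models

variable {Q : Type*} [Dist Q]

/-- `Q` is isometric to a closed interval `[0, ℓ]` with `0 < ℓ`, and `f` corresponds to the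
reflection `t ↦ ℓ - t` of this interval in its midpoint. -/
def IsIntervalReflection (f : Q → Q) : Prop :=
  ∃ ℓ : ℝ, 0 < ℓ ∧ ∃ φ : Q ≃ Set.Icc (0 : ℝ) ℓ,
    (∀ p q, dist (φ p) (φ q) = dist p q) ∧ ∀ p, ((φ (f p) : ℝ)) = ℓ - (φ p : ℝ)

/-- `Q` is isometric to a circle `ℝ/ℓℤ` of some length `0 < ℓ`, and `f` corresponds to a
reflection `t ↦ c - t` of this circle. -/
def IsCircleReflection (f : Q → Q) : Prop :=
  ∃ ℓ : ℝ, 0 < ℓ ∧ ∃ φ : Q ≃ AddCircle ℓ,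
    (∀ p q, dist (φ p) (φ q) = dist p q) ∧ ∃ c : AddCircle ℓ, ∀ p, φ (f p) = c - φ p

/-- `Q` is isometric to a circle `ℝ/ℓℤ` of some length `0 < ℓ`, and `f` corresponds to the
rotation of this circle by the angle `θ` (in radians), that is, to the translation of `ℝ/ℓℤ`
by `(θ / 2π) ℓ`. -/
def IsCircleRotation (f : Q → Q) (θ : ℝ) : Prop :=
  ∃ ℓ : ℝ, 0 < ℓ ∧ ∃ φ : Q ≃ AddCircle ℓ,
    (∀ p q, dist (φ p) (φ q) = dist p q) ∧
      ∀ p, φ (f p) = φ p + ((θ / (2 * Real.pi) * ℓ : ℝ) : AddCircle ℓ)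

end Models

/-! ### Infinite cyclic and infinite dihedral groups -/

/-- `G` is an infinite cyclic group. -/
def IsInfiniteCyclic (G : Type*) [Group G] : Prop :=
  Nonempty (G ≃* Multiplicative ℤ)

/-- `G` is an infinite dihedral group. -/
def IsInfiniteDihedral (G : Type*) [Group G] : Prop :=
  Nonempty (G ≃* DihedralGroup 0)

/-- `{a, b}` is a set of Coxeter generators of `G`: two elements of order two that generate `G`. -/
def IsCoxeterGenerators {G : Type*} [Group G] (a b : G) : Prop :=
  orderOf a = 2 ∧ orderOf b = 2 ∧ Subgroup.closure {a, b} = ⊤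

/-! ### Space groups -/

/-- Euclidean `n`-space. -/
abbrev E (n : ℕ) : Type := EuclideanSpace ℝ (Fin n)

/-- The group of isometries `a + A` of Euclidean `n`-space. -/
abbrev Isom (n : ℕ) : Type := E n ≃ᵃⁱ[ℝ] E n

/-- The action of the isometry group on `E n`. -/
def isomAction (n : ℕ) : Isom n →* Equiv.Perm (E n) where
  toFun γ := γ.toEquiv
  map_one' := rfl
  map_mul' _ _ := rfl

/-- The pair `(a, A)` of the isometry `a + A`. The usual topology of the isometry group is the
one induced by this injection. -/
def isomCoords {n : ℕ} (γ : Isom n) : E n × (E n →L[ℝ] E n) :=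
  (γ 0, (γ.linearIsometryEquiv : E n →L[ℝ] E n))

/-- An `n`-space group: a discrete group of isometries of `E n` with compact orbit space. -/
structure IsSpaceGroup {n : ℕ} (Γ : Subgroup (Isom n)) : Prop where
  discrete : IsDiscrete (isomCoords '' (Γ : Set (Isom n)))
  cocompact : CompactSpace (OrbitSpace (isomAction n) Γ)

section Pair

variable {n : ℕ} {Γ : Subgroup (Isom n)}

/-- `Span(N)`: the span of all `a` such that the translation `a + I` belongs to `N`. -/
def spanOf (N : Subgroup Γ) : Submodule ℝ (E n) :=
  Submodule.span ℝ {a | ∃ ν ∈ N, ((ν : Γ) : Isom n) = AffineIsometryEquiv.constVAdd ℝ (E n) a}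

/-- The linear parts of the elements of `Γ` preserve the span of a normal subgroup. -/
theorem linear_mem_spanOf (N : Subgroup Γ) [hN : N.Normal] (γ : Γ) {v : E n}
    (hv : v ∈ spanOf N) : (γ : Isom n).linearIsometryEquiv v ∈ spanOf N := by
  induction hv using Submodule.span_induction with
  | mem a ha =>
    obtain ⟨ν, hν, hνa⟩ := ha
    refine Submodule.subset_span ⟨γ * ν * γ⁻¹, hN.conj_mem ν hν γ, ?_⟩
    ext1 x
    have h := (γ : Isom n).map_vadd ((γ : Isom n)⁻¹ x) a
    have h1 : (γ : Isom n) ((γ : Isom n)⁻¹ x) = x := (γ : Isom n).apply_symm_apply x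
    rw [h1] at h
    simpa [hνa] using h
  | zero => simp
  | add a b _ _ ha hb => simpa using Submodule.add_mem _ ha hb
  | smul c a _ ha => simpa using Submodule.smul_mem _ c ha

/-- The linear parts of the elements of `Γ` preserve the orthogonal complement of the span of a
normal subgroup. -/
theorem linear_mem_spanOf_orthogonal (N : Subgroup Γ) [N.Normal] (γ : Γ) {w : E n}
    (hw : w ∈ (spanOf N)ᗮ) : (γ : Isom n).linearIsometryEquiv w ∈ (spanOf N)ᗮ := by
  rw [Submodule.mem_orthogonal] at hw ⊢
  intro v hv
  have h := hw _ (linear_mem_spanOf N γ⁻¹ hv)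
  rw [← (γ : Isom n).linearIsometryEquiv.inner_map_map] at h
  have h2 : (γ : Isom n).linearIsometryEquiv (((γ⁻¹ : Γ) : Isom n).linearIsometryEquiv v) = v :=
    (γ : Isom n).linearIsometryEquiv.apply_symm_apply v
  rwa [h2] at h

/-- If the linear parts of `Γ` preserve the orthogonal complement of `W` (and hence `W`), then `Γ`
acts on `W`: the element `b + B` acts as `c + B`, where `c` is the orthogonal projection of `b` to
`W`. As a map, this is `b + B` restricted to `W`, followed by the orthogonal projection to `W`. -/
def projAction (W : Submodule ℝ (E n))
    (hW : ∀ (γ : Γ) (w : E n), w ∈ Wᗮ → (γ : Isom n).linearIsometryEquiv w ∈ Wᗮ) :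
    Γ →* Equiv.Perm W :=
  MonoidHom.toHomPerm
    { toFun := fun γ w => W.orthogonalProjectionOnto ((γ : Isom n) (w : E n))
      map_one' := by
        funext w
        exact W.orthogonalProjectionOnto_mem_subspace_eq_self w
      map_mul' := by
        intro γ δ
        funext w
        have h : (δ : Isom n) (w : E n)
            - (W.orthogonalProjectionOnto ((δ : Isom n) (w : E n)) : E n) ∈ Wᗮ :=
          W.sub_starProjection_mem_orthogonal _
        have h2 := hW γ _ h
        have h3 := (γ : Isom n).map_vsub ((δ : Isom n) (w : E n))
          (W.orthogonalProjectionOnto ((δ : Isom n) (w : E n)) : E n)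
        rw [vsub_eq_sub, vsub_eq_sub] at h3
        rw [h3, ← Submodule.orthogonalProjectionOnto_eq_zero_iff, map_sub, sub_eq_zero] at h2
        exact h2 }

theorem projAction_apply (W : Submodule ℝ (E n))
    (hW : ∀ (γ : Γ) (w : E n), w ∈ Wᗮ → (γ : Isom n).linearIsometryEquiv w ∈ Wᗮ)
    (γ : Γ) (w : W) :
    projAction W hW γ w = W.orthogonalProjectionOnto ((γ : Isom n) (w : E n)) := rfl

variable (N : Subgroup Γ) [N.Normal]

/-- The action of `Γ` on `V = Span(N)`. -/
def spanAction : Γ →* Equiv.Perm (spanOf N) :=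
  projAction (spanOf N) fun γ _ hw => linear_mem_spanOf_orthogonal N γ hw

/-- The action of `Γ` on the orthogonal complement `Vᗮ` of `V = Span(N)`. -/
def perpAction : Γ →* Equiv.Perm ((spanOf N)ᗮ : Submodule ℝ (E n)) :=
  projAction (spanOf N)ᗮ fun γ w hw => by
    rw [Submodule.orthogonal_orthogonal] at hw ⊢
    exact linear_mem_spanOf N γ hw

/-- The kernel `K` of the action of `Γ` on `V = Span(N)`. -/
def actionKernel : Subgroup Γ := (spanAction N).ker

instance actionKernel_normal : (actionKernel N).Normal :=
  inferInstanceAs (spanAction N).ker.Normal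

/-- The structure group `Γ/NK`; here `NK` is the join of the normal subgroups `N` and `K`. -/
abbrev StructureGroup : Type := Γ ⧸ (N ⊔ actionKernel N)

/-- The coset `γNK` in the structure group. -/
abbrev toStructureGroup (γ : Γ) : StructureGroup N :=
  QuotientGroup.mk' (N ⊔ actionKernel N) γ

/-- The orbit space `Vᗮ/K`, with the orbit space distance. -/
abbrev PerpOrbitSpace : Type := OrbitSpace (perpAction N) (actionKernel N)

/-- The action of `(b + B)NK` on `Vᗮ/K`: it sends `Kw` to `K(d + Bw)`, where `d` is the orthogonal
projection of `b` to `Vᗮ`. -/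
def perpOrbitMap (γ : Γ) : PerpOrbitSpace N → PerpOrbitSpace N :=
  OrbitSpace.map (perpAction N) (actionKernel N) γ

end Pair

end FlatFibration

end

/-! Everything reduces to a computation in the infinite dihedral group `D = Γ/N` acting on a line.
By `exists_line_coordinate`, `Vᗮ` is one-dimensional, `N` acts trivially on it, and in a suitable
coordinate `D` acts in the standard way: its rotations are translations by multiples of some `a >
0`, and the mirrors of its reflections are spaced `a/2` apart. This rests on Bieberbach's theorem in
two forms, `IsSpaceGroup.span_translations` and `IsSpaceGroup.exists_pow_linPart_eq_one`. An element
of `K ∩ N` fixes both `V` and `Vᗮ` pointwise, so `K` embeds in `D` as a normal subgroup `H` whose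
index is the order of `Γ/NK`.

Coxeter generators of `D` are exactly the pairs of reflections in adjacent mirrors
(`isCoxeterGenerators_iff`), so the question is which pairs of `D` are congruent modulo `H` to such
a pair. There are three kinds of `H`. If `H = D`, every pair qualifies. If `H` contains a reflection
but not the unit rotation, it has index 2, `Vᗮ/K` is an interval of length `a`, every element
outside `H` reflects it, and a pair qualifies exactly when one member lies in `H` and the other does
not. If `H` contains no reflection, it consists of the rotations by multiples of some `m`, the index
is `2m`, `Vᗮ/K` is a circle of length `am`, and a pair qualifies exactly when both members are
reflections whose product rotates by `±1` modulo `m`. The case analysis is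
`isCoxeterPairMod_map_iff`. -/

/-! ### Bieberbach's theorem on translations -/

namespace FlatFibration

section Bieberbach

variable {n : ℕ} {Γ : Subgroup (Isom n)}

/-- The linear part of an isometry, as a continuous linear map. -/
noncomputable def linPart (γ : Isom n) : E n →L[ℝ] E n := (isomCoords γ).2

theorem linPart_apply (γ : Isom n) (x : E n) : linPart γ x = γ.linearIsometryEquiv x := rfl

theorem isom_apply (γ : Isom n) (x : E n) : γ x = linPart γ x + γ 0 := by
  have h := γ.map_vadd 0 x
  simpa [linPart_apply] using h

theorem linPart_mul (γ δ : Isom n) : linPart (γ * δ) = linPart γ * linPart δ := rfl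

theorem linPart_one : linPart (1 : Isom n) = 1 := rfl

theorem norm_linPart_apply (γ : Isom n) (x : E n) : ‖linPart γ x‖ = ‖x‖ :=
  γ.linearIsometryEquiv.norm_map x

theorem linPart_mul_inv (γ : Isom n) : linPart γ * linPart γ⁻¹ = 1 := by
  rw [← linPart_mul, mul_inv_cancel, linPart_one]

theorem linPart_inv_mul (γ : Isom n) : linPart γ⁻¹ * linPart γ = 1 := by
  rw [← linPart_mul, inv_mul_cancel, linPart_one]

theorem norm_mul_linPart_le (A : E n →L[ℝ] E n) (γ : Isom n) : ‖A * linPart γ‖ ≤ ‖A‖ :=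
  ContinuousLinearMap.opNorm_le_bound _ (norm_nonneg _) fun x => by
    simpa [norm_linPart_apply] using A.le_opNorm (linPart γ x)

theorem norm_linPart_mul_le (A : E n →L[ℝ] E n) (γ : Isom n) : ‖linPart γ * A‖ ≤ ‖A‖ :=
  ContinuousLinearMap.opNorm_le_bound _ (norm_nonneg _) fun x => by
    simpa [norm_linPart_apply] using A.le_opNorm x

theorem norm_linPart_le (γ : Isom n) : ‖linPart γ‖ ≤ 1 :=
  ContinuousLinearMap.opNorm_le_bound _ zero_le_one fun x => by
    simp [norm_linPart_apply]

theorem isom_ext {γ δ : Isom n} (h : linPart γ = linPart δ) (h0 : γ 0 = δ 0) : γ = δ := by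
  ext1 x
  rw [isom_apply γ, isom_apply δ, h, h0]

theorem isomCoords_injective : Function.Injective (isomCoords (n := n)) := fun _ _ h =>
  isom_ext (congrArg Prod.snd h) (congrArg Prod.fst h)

theorem norm_linPart_mul_inv_sub_one_le (γ δ : Isom n) :
    ‖linPart (γ * δ⁻¹) - 1‖ ≤ ‖linPart γ - linPart δ‖ := by
  have h : linPart (γ * δ⁻¹) - 1 = (linPart γ - linPart δ) * linPart δ⁻¹ := by
    rw [sub_mul, linPart_mul_inv, linPart_mul]
  rw [h]
  exact norm_mul_linPart_le _ _

theorem norm_inv_apply_zero (γ : Isom n) : ‖γ⁻¹ 0‖ = ‖γ 0‖ := by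
  have h : γ (γ⁻¹ 0) = 0 := γ.apply_symm_apply 0
  rw [isom_apply] at h
  rw [← norm_linPart_apply γ, eq_neg_of_add_eq_zero_left h, norm_neg]

theorem mul_inv_apply_zero (γ δ : Isom n) :
    (γ * δ⁻¹) 0 = (linPart γ - linPart δ) (δ⁻¹ 0) + (γ 0 - δ 0) := by
  have h : δ (δ⁻¹ 0) = 0 := δ.apply_symm_apply 0
  rw [isom_apply] at h
  have h2 : (γ * δ⁻¹) 0 = linPart γ (δ⁻¹ 0) + γ 0 := isom_apply γ _
  rw [h2, sub_apply, eq_neg_of_add_eq_zero_left h]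
  abel

theorem IsSpaceGroup.exists_isolated (hΓ : IsSpaceGroup Γ) :
    ∃ ε > 0, ∀ γ ∈ Γ, ‖γ 0‖ < ε → ‖linPart γ - 1‖ < ε → γ = 1 := by
  obtain ⟨ε, hε, h⟩ := Metric.exists_ball_inter_eq_singleton_of_mem_discrete hΓ.discrete
    (Set.mem_image_of_mem isomCoords Γ.one_mem)
  refine ⟨ε, hε, fun γ hγ h1 h2 => isomCoords_injective ?_⟩
  have : isomCoords γ ∈ Metric.ball (isomCoords 1) ε ∩ isomCoords '' (Γ : Set (Isom n)) := by
    refine ⟨?_, Set.mem_image_of_mem _ hγ⟩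
    rw [mem_ball_iff_norm, Prod.norm_def, max_lt_iff]
    refine ⟨?_, h2⟩
    change ‖γ 0 - 0‖ < ε
    rwa [sub_zero]
  rwa [h] at this

/-- Cover the compact set of possible coordinates by small balls. If `γ` and `δ` share a ball, then
`γ * δ⁻¹` is too close to the identity to differ from it. The factor `R + 1` in the radius absorbs
the rotational difference applied to a vector of norm at most `R`. -/
theorem IsSpaceGroup.finite_norm_le (hΓ : IsSpaceGroup Γ) (R : ℝ) :
    {γ | γ ∈ Γ ∧ ‖γ 0‖ ≤ R}.Finite := by
  wlog hR : 0 ≤ R generalizing R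
  · exact (this 0 le_rfl).subset fun γ hγ => ⟨hγ.1, hγ.2.trans (not_le.1 hR).le⟩
  obtain ⟨ε, hε, h⟩ := hΓ.exists_isolated
  refine Set.Finite.of_finite_image ?_ isomCoords_injective.injOn
  set S := {γ | γ ∈ Γ ∧ ‖γ 0‖ ≤ R}
  have hη : 0 < ε / (4 * (R + 1)) := by positivity
  obtain ⟨t, -, htf, ht⟩ := (isCompact_closedBall (0 : E n × (E n →L[ℝ] E n))
    (max R 1)).finite_cover_balls hη
  have hsub : isomCoords '' S ⊆ ⋃ p ∈ t, Metric.ball p (ε / (4 * (R + 1))) ∩ isomCoords '' S := by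
    rintro _ ⟨γ, hγ, rfl⟩
    have hmem : isomCoords γ ∈ Metric.closedBall (0 : E n × (E n →L[ℝ] E n)) (max R 1) := by
      rw [mem_closedBall_zero_iff, Prod.norm_def]
      exact max_le_max hγ.2 (norm_linPart_le γ)
    obtain ⟨p, hp, hp2⟩ := Set.mem_iUnion₂.1 (ht hmem)
    exact Set.mem_iUnion₂.2 ⟨p, hp, hp2, Set.mem_image_of_mem _ hγ⟩
  refine (htf.biUnion fun p _ => Set.Subsingleton.finite ?_).subset hsub
  rintro _ ⟨hγp, γ, hγ, rfl⟩ _ ⟨hδp, δ, hδ, rfl⟩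
  have hd : dist (isomCoords γ) (isomCoords δ) < ε / (2 * (R + 1)) := by
    have := dist_triangle_right (isomCoords γ) (isomCoords δ) p
    rw [Metric.mem_ball] at hγp hδp
    have e : ε / (2 * (R + 1)) = ε / (4 * (R + 1)) + ε / (4 * (R + 1)) := by
      field_simp; ring
    linarith
  rw [dist_eq_norm, Prod.norm_def, max_lt_iff] at hd
  have hd1 : ‖γ 0 - δ 0‖ < ε / (2 * (R + 1)) := hd.1
  have hd2 : ‖linPart γ - linPart δ‖ < ε / (2 * (R + 1)) := hd.2
  have hle : ε / (2 * (R + 1)) * (R + 1) = ε / 2 := by field_simp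
  have hle' : ε / (2 * (R + 1)) ≤ ε / 2 := by
    rw [← hle]; exact le_mul_of_one_le_right (by positivity) (by linarith)
  congr 1
  rw [← mul_inv_eq_one]
  refine h _ (Γ.mul_mem hγ.1 (Γ.inv_mem hδ.1)) ?_ ?_
  · rw [mul_inv_apply_zero]
    calc _ ≤ ‖linPart γ - linPart δ‖ * ‖δ⁻¹ 0‖ + ‖γ 0 - δ 0‖ :=
          (norm_add_le _ _).trans (add_le_add_left ((linPart γ - linPart δ).le_opNorm _) _)
      _ < ε / (2 * (R + 1)) * R + ε / (2 * (R + 1)) := by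
          refine add_lt_add_of_le_of_lt ?_ hd1
          rw [norm_inv_apply_zero]
          exact mul_le_mul hd2.le hδ.2 (norm_nonneg _) (by positivity)
      _ ≤ ε := by linarith
  · linarith [norm_linPart_mul_inv_sub_one_le γ δ]

/-- The images of the balls about the origin form an increasing open cover of the compact orbit
space, so one of them is everything. -/
theorem IsSpaceGroup.exists_norm_sub_le (hΓ : IsSpaceGroup Γ) :
    ∃ d : ℝ, ∀ x : E n, ∃ γ ∈ Γ, ‖γ 0 - x‖ ≤ d := by
  have := hΓ.cocompact
  let π : E n → OrbitSpace (isomAction n) Γ := Quotient.mk _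
  have hopen : ∀ k : ℕ, IsOpen (π '' Metric.ball 0 k) := fun k => by
    refine isOpen_coinduced.2 ?_
    have h : π ⁻¹' (π '' Metric.ball 0 k) = ⋃ γ ∈ Γ, (fun x => γ x) ⁻¹' Metric.ball 0 (k : ℝ) := by
      ext x
      simp only [Set.mem_preimage, Set.mem_image, Set.mem_iUnion]
      constructor
      · rintro ⟨y, hy, hyx⟩
        obtain ⟨γ, hγ, h⟩ := Quotient.exact hyx.symm
        exact ⟨γ, hγ, by have h' : γ x = y := h
                         rwa [h']⟩
      · rintro ⟨γ, hγ, h⟩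
        exact ⟨γ x, h, (Quotient.sound ⟨γ, hγ, rfl⟩ : π x = π (γ x)).symm⟩
    exact h ▸ isOpen_biUnion fun γ _ => Metric.isOpen_ball.preimage γ.continuous
  obtain ⟨k, hk⟩ := isCompact_univ.elim_directed_cover _ hopen (by
      rintro p -
      obtain ⟨x, rfl⟩ := Quotient.exists_rep p
      obtain ⟨k, hk⟩ := exists_nat_gt ‖x‖
      exact Set.mem_iUnion.2 ⟨k, x, by simpa using hk, rfl⟩)
    (Monotone.directed_le fun i j hij => Set.image_mono
      (Metric.ball_subset_ball (by exact_mod_cast hij)))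
  refine ⟨k, fun x => ?_⟩
  obtain ⟨y, hy, hyx⟩ := hk (Set.mem_univ (π x))
  obtain ⟨γ, hγ, h⟩ := Quotient.exact hyx
  refine ⟨γ, hγ, ?_⟩
  have h' : γ y = x := h
  rw [← h', ← dist_eq_norm, γ.dist_map, dist_comm, dist_zero_right]
  exact (mem_ball_zero_iff.1 hy).le

end Bieberbach

/-! ### Elements with small rotational part are translations (minimality and commutators) -/

section Bieberbach

variable {n : ℕ} {Γ : Subgroup (Isom n)}

/-- Orbit points stay within a fixed distance of the points `k • u`. By compactness two of the
corresponding rotational parts nearly agree; the quotient of these two elements nearly is a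
translation, with an error that stays bounded while `t` grows. -/
theorem IsSpaceGroup.exists_near_direction (hΓ : IsSpaceGroup Γ) (u : E n) {ε : ℝ} (hε : 0 < ε) :
    ∃ β ∈ Γ, ∃ t : ℝ, 0 < t ∧ ‖β 0 - t • u‖ ≤ ε * t ∧ ‖linPart β - 1‖ ≤ ε := by
  obtain ⟨d, hd⟩ := hΓ.exists_norm_sub_le
  choose β hβ hβd using fun k : ℕ => hd ((k : ℝ) • u)
  obtain ⟨A, -, φ, hφ, hA⟩ := (isCompact_closedBall (0 : E n →L[ℝ] E n) 1).tendsto_subseq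
    (x := fun k => linPart (β k)) fun k => mem_closedBall_zero_iff.2 (norm_linPart_le _)
  obtain ⟨N, hN⟩ := Metric.cauchySeq_iff.1 hA.cauchySeq ε hε
  set C := ε * ‖β (φ N) 0‖ + (d + ‖β (φ N) 0‖)
  obtain ⟨j, hj⟩ := exists_nat_gt (max (C / ε) N)
  obtain ⟨hjC, hjN⟩ := max_lt_iff.1 hj
  have hjN' : N < j := by exact_mod_cast hjN
  have hjφ : (j : ℝ) ≤ φ j := by exact_mod_cast hφ.le_apply
  have hlin : ‖linPart (β (φ j)) - linPart (β (φ N))‖ ≤ ε := by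
    rw [← dist_eq_norm]; exact (hN j hjN'.le N le_rfl).le
  refine ⟨β (φ j) * (β (φ N))⁻¹, Γ.mul_mem (hβ _) (Γ.inv_mem (hβ _)), φ j, ?_, ?_,
    (norm_linPart_mul_inv_sub_one_le _ _).trans hlin⟩
  · have : (0 : ℝ) ≤ N := N.cast_nonneg
    linarith
  · rw [mul_inv_apply_zero]
    have e : ∀ x y z w : E n, x + (y - z) - w = x + ((y - w) - z) := fun x y z w => by abel
    rw [e]
    calc _ ≤ ε * ‖β (φ N) 0‖ + (d + ‖β (φ N) 0‖) := by
          refine (norm_add_le _ _).trans (add_le_add ?_ ((norm_sub_le _ _).trans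
            (add_le_add_left (hβd _) _)))
          refine (ContinuousLinearMap.le_opNorm _ _).trans ?_
          rw [norm_inv_apply_zero]
          exact mul_le_mul_of_nonneg_right hlin (norm_nonneg _)
      _ ≤ ε * φ j := by
          rw [div_lt_iff₀ hε] at hjC
          nlinarith

theorem IsSpaceGroup.exists_min_norm (hΓ : IsSpaceGroup Γ) {p : Isom n → Prop}
    (hp : ∃ γ ∈ Γ, p γ) : ∃ γ ∈ Γ, p γ ∧ ∀ δ ∈ Γ, p δ → ‖γ 0‖ ≤ ‖δ 0‖ := by
  obtain ⟨γ₀, hγ₀, hp₀⟩ := hp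
  obtain ⟨γ, ⟨⟨hγ, hγ'⟩, hpγ⟩, hmin⟩ := Set.exists_min_image
    ({γ | γ ∈ Γ ∧ ‖γ 0‖ ≤ ‖γ₀ 0‖} ∩ {γ | p γ}) (fun γ => ‖γ 0‖)
    ((hΓ.finite_norm_le _).inter_of_left _) ⟨γ₀, ⟨hγ₀, le_rfl⟩, hp₀⟩
  refine ⟨γ, hγ, hpγ, fun δ hδ hpδ => ?_⟩
  by_cases h : ‖δ 0‖ ≤ ‖γ₀ 0‖
  · exact hmin δ ⟨⟨hδ, h⟩, hpδ⟩
  · exact hγ'.trans (not_le.1 h).le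

/-- A linear map on a nontrivial finite-dimensional space attains its operator norm. -/
theorem exists_unit_norm_map_eq {F G : Type*} [NormedAddCommGroup F] [NormedSpace ℝ F]
    [FiniteDimensional ℝ F] [Nontrivial F] [NormedAddCommGroup G] [NormedSpace ℝ G]
    (D : F →L[ℝ] G) : ∃ x, ‖x‖ = 1 ∧ ‖D x‖ = ‖D‖ := by
  have : ProperSpace F := FiniteDimensional.proper_real F
  obtain ⟨x, hx, hmax⟩ := (isCompact_sphere (0 : F) 1).exists_isMaxOn
    (NormedSpace.sphere_nonempty.2 zero_le_one) (f := fun x => ‖D x‖)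
    D.continuous.norm.continuousOn
  have hx1 : ‖x‖ = 1 := by simpa using hx
  refine ⟨x, hx1, le_antisymm (by simpa [hx1] using D.le_opNorm x) ?_⟩
  refine D.opNorm_le_of_unit_norm (norm_nonneg _) fun y hy => hmax (by simpa using hy)

/-- The invariant subspace on which the displacement `A - 1` of an orthogonal map is maximal. -/
theorem exists_maximal_displacement_subspace (α : Isom n) (hα : linPart α ≠ 1) :
    ∃ (W : Submodule ℝ (E n)) (c : ℝ), 0 ≤ c ∧ c < ‖linPart α - 1‖ ∧ (∃ u ∈ W, ‖u‖ = 1) ∧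
      (∀ x ∈ W, (linPart α - 1) x ∈ W) ∧ (∀ x ∈ Wᗮ, (linPart α - 1) x ∈ Wᗮ) ∧
      (∀ x ∈ W, ‖(linPart α - 1) x‖ = ‖linPart α - 1‖ * ‖x‖) ∧
      ∀ x ∈ Wᗮ, ‖(linPart α - 1) x‖ ≤ c * ‖x‖ := by
  set A := linPart α with hA
  set A' := linPart α⁻¹ with hA'
  have hAA' : A * A' = 1 := linPart_mul_inv α
  have hA'A : A' * A = 1 := linPart_inv_mul α
  set m := ‖A - 1‖ with hm
  have hA'm : ‖A' - 1‖ ≤ m := by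
    have : A' - 1 = -(A' * (A - 1)) := by rw [mul_sub, hA'A]; simp
    rw [this, norm_neg]
    exact norm_linPart_mul_le _ _
  have hadj : ∀ x y, inner ℝ (A x) y = inner ℝ x (A' y) := fun x y => by
    have : A (A' y) = y := congrArg (fun B : E n →L[ℝ] E n => B y) hAA'
    conv_lhs => rw [← this]
    exact α.linearIsometryEquiv.inner_map_map x (A' y)
  have hnt : Nontrivial (E n) := by
    by_contra h
    rw [not_nontrivial_iff_subsingleton] at h
    exact hα (ContinuousLinearMap.ext fun x => Subsingleton.elim _ _)
  set T := (A' - 1) * (A - 1) with hT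
  have hcomm : T * A = A * T := by
    simp only [hT, sub_mul, mul_sub, hA'A, one_mul, mul_one]
    simp only [hAA']
  have hcomm' : T * A' = A' * T := by
    have := congrArg (fun B => A' * B * A') hcomm
    simp only [mul_assoc, hAA', mul_one] at this
    rw [this, ← mul_assoc A', hA'A, one_mul]
  have hinner : ∀ x, inner ℝ (T x) x = ‖(A - 1) x‖ ^ 2 := fun x => by
    have h : ∀ y, inner ℝ ((A' - 1) y) x = inner ℝ y ((A - 1) x) := fun y => by
      simp only [sub_apply, one_apply_eq_self, inner_sub_left,
        inner_sub_right]
      rw [real_inner_comm x (A' y), ← hadj, real_inner_comm]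
    rw [← real_inner_self_eq_norm_sq]
    exact h _
  -- `T` is the adjoint of `A - 1` times `A - 1`, and `W` is its eigenspace for the top eigenvalue
  -- `m ^ 2`.
  let W : Submodule ℝ (E n) := LinearMap.ker ((T - m ^ 2 • (1 : E n →L[ℝ] E n) :
    E n →L[ℝ] E n) : E n →ₗ[ℝ] E n)
  have hW : ∀ x, x ∈ W ↔ T x = m ^ 2 • x := fun x => by
    rw [LinearMap.mem_ker]
    change T x - m ^ 2 • x = 0 ↔ _
    exact sub_eq_zero
  -- Equality in the norm bound forces an eigenvector: the expansion of `‖T x - m ^ 2 • x‖ ^ 2` is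
  -- at most `m⁴ - 2m⁴ + m⁴` times `‖x‖ ^ 2`.
  have hmax : ∀ x, ‖(A - 1) x‖ = m * ‖x‖ → x ∈ W := fun x hx => by
    rw [hW, ← sub_eq_zero, ← norm_eq_zero, ← sq_eq_zero_iff]
    refine le_antisymm ?_ (sq_nonneg _)
    have hTx : ‖T x‖ ≤ m * (m * ‖x‖) := by
      rw [← hx]
      exact ((A' - 1).le_opNorm _).trans (mul_le_mul_of_nonneg_right hA'm (norm_nonneg _))
    have hTx2 : ‖T x‖ ^ 2 ≤ (m * (m * ‖x‖)) ^ 2 := pow_le_pow_left₀ (norm_nonneg _) hTx 2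
    rw [norm_sub_sq_real, inner_smul_right, hinner, hx, norm_smul, Real.norm_of_nonneg (sq_nonneg m)]
    nlinarith
  have hinvA : ∀ x ∈ W, A x ∈ W := fun x hx => by
    rw [hW] at hx ⊢
    have : T (A x) = A (T x) := congrArg (fun B : E n →L[ℝ] E n => B x) hcomm
    rw [this, hx, map_smul]
  have hinvA' : ∀ x ∈ W, A' x ∈ W := fun x hx => by
    rw [hW] at hx ⊢
    have : T (A' x) = A' (T x) := congrArg (fun B : E n →L[ℝ] E n => B x) hcomm'
    rw [this, hx, map_smul]
  have hWnorm : ∀ x ∈ W, ‖(A - 1) x‖ = m * ‖x‖ := fun x hx => by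
    have h := hinner x
    rw [(hW x).1 hx, inner_smul_left, real_inner_self_eq_norm_sq] at h
    rw [← sq_eq_sq₀ (norm_nonneg _) (by positivity), ← h]
    simp [mul_pow]
  have hm0 : 0 < m := norm_pos_iff.2 (sub_ne_zero.2 hα)
  have key : ∃ c, 0 ≤ c ∧ c < m ∧ ∀ x ∈ Wᗮ, ‖(A - 1) x‖ ≤ c * ‖x‖ := by
    set D : Wᗮ →L[ℝ] E n := (A - 1).comp Wᗮ.subtypeL
    have hD : ∀ x ∈ Wᗮ, ‖(A - 1) x‖ ≤ ‖D‖ * ‖x‖ := fun x hx => D.le_opNorm ⟨x, hx⟩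
    refine ⟨‖D‖, D.opNorm_nonneg, ?_, hD⟩
    rcases subsingleton_or_nontrivial (Wᗮ : Submodule ℝ (E n)) with h | h
    · refine (D.opNorm_le_bound le_rfl fun x => ?_).trans_lt hm0
      rw [Subsingleton.elim x 0]
      simp
    · obtain ⟨x, hx, hDx⟩ := exists_unit_norm_map_eq D
      have hDx' : ‖(A - 1) (x : E n)‖ = ‖D‖ := hDx
      have hx' : ‖(x : E n)‖ = 1 := hx
      have hle : ‖D‖ ≤ m := by
        rw [← hDx']; simpa [hx'] using (A - 1).le_opNorm (x : E n)
      refine lt_of_le_of_ne hle fun heq => ?_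
      have hxW : (x : E n) ∈ W := hmax _ (by rw [hDx', heq, hx', mul_one])
      have := W.inner_right_of_mem_orthogonal hxW x.2
      rw [real_inner_self_eq_norm_sq, hx'] at this
      norm_num at this
  obtain ⟨c, hc0, hcm, hc⟩ := key
  obtain ⟨u, hu, hDu⟩ := exists_unit_norm_map_eq (A - 1)
  refine ⟨W, c, hc0, hcm, ⟨u, hmax u (by rw [hDu, hu, mul_one]), hu⟩,
    fun x hx => W.sub_mem (hinvA x hx) hx, fun x hx => Wᗮ.sub_mem ?_ hx, hWnorm, hc⟩
  rw [Submodule.mem_orthogonal'] at hx ⊢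
  intro y hy
  exact (hadj x y).trans (hx _ (hinvA' y hy))

/-- The commutator moves the origin by `(A - 1) b` up to a remainder that is small when the
rotational part of `β` is near 1. -/
theorem commutator_apply_zero (α β : Isom n) :
    (α * β * α⁻¹ * β⁻¹) 0 = (linPart α - 1) (β 0) +
      ((1 - linPart (α * β * α⁻¹ * β⁻¹)) (β 0) +
        (1 - linPart α * linPart β * linPart α⁻¹) (α 0)) := by
  set κ := α * β * α⁻¹ * β⁻¹ with hκ
  have h : κ * (β * α) = α * β := by rw [hκ]; group
  have h1 : κ (β (α 0)) = α (β 0) := congrArg (fun γ : Isom n => γ 0) h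
  have h2 : linPart κ * linPart β = linPart α * linPart β * linPart α⁻¹ := by
    rw [← linPart_mul, ← linPart_mul, ← linPart_mul, hκ]
    congr 1
    group
  have h3 : linPart κ (linPart β (α 0)) = (linPart α * linPart β * linPart α⁻¹) (α 0) :=
    congrArg (fun B : E n →L[ℝ] E n => B (α 0)) h2
  rw [isom_apply κ, isom_apply β (α 0), isom_apply α (β 0), map_add, h3] at h1
  rw [eq_sub_of_add_eq' h1]
  simp only [sub_apply, one_apply_eq_self]
  abel

/-- The bound is quadratic because `AB - BA` is also the commutator of `A - 1` and `B - 1`. Once `‖A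
- 1‖ ≤ 1/2`, commutation with `α` does not increase the rotational part. -/
theorem norm_linPart_commutator_sub_one_le (α β : Isom n) :
    ‖linPart (α * β * α⁻¹ * β⁻¹) - 1‖ ≤ 2 * ‖linPart α - 1‖ * ‖linPart β - 1‖ := by
  have h : linPart (α * β * α⁻¹ * β⁻¹) - 1 = ((linPart α - 1) * (linPart β - 1) -
      (linPart β - 1) * (linPart α - 1)) * linPart (α⁻¹ * β⁻¹) := by
    have e : (linPart α - 1) * (linPart β - 1) - (linPart β - 1) * (linPart α - 1) =
        linPart (α * β) - linPart (β * α) := by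
      rw [linPart_mul, linPart_mul]
      simp only [sub_mul, mul_sub, one_mul, mul_one]
      abel
    rw [e, sub_mul, ← linPart_mul, ← linPart_mul]
    have e1 : β * α * (α⁻¹ * β⁻¹) = 1 := by group
    rw [e1, linPart_one]
    simp only [mul_assoc]
  rw [h]
  refine (norm_mul_linPart_le _ _).trans ((norm_sub_le _ _).trans ?_)
  have h1 := norm_mul_le (linPart α - 1) (linPart β - 1)
  have h2 := norm_mul_le (linPart β - 1) (linPart α - 1)
  linarith

/-- Elements of a space group with small rotational part are translations. -/
theorem IsSpaceGroup.linPart_eq_one (hΓ : IsSpaceGroup Γ) {γ : Isom n} (hγ : γ ∈ Γ)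
    (h : ‖linPart γ - 1‖ ≤ 1 / 2) : linPart γ = 1 := by
  by_contra hne
  -- Take a shortest counterexample `α`, then a shortest `β` that points mainly along the subspace
  -- `W` of maximal displacement of `α` and hardly rotates. Their commutator meets the conditions on
  -- `β` and is shorter.
  obtain ⟨α, hα, ⟨hα2, hαne⟩, hαmin⟩ := hΓ.exists_min_norm
    (p := fun α => ‖linPart α - 1‖ ≤ 1 / 2 ∧ linPart α ≠ 1) ⟨γ, hγ, h, hne⟩
  obtain ⟨W, c, hc0, hcm, ⟨u, huW, hu⟩, hDW, hDW', hW, hW'⟩ :=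
    exists_maximal_displacement_subspace α hαne
  set D := linPart α - 1 with hD
  set P := W.starProjection with hP
  have hPle : ∀ x, ‖P x‖ ≤ ‖x‖ := fun x => W.norm_starProjection_apply_le x
  have hPsub : ∀ x, ‖x - P x‖ ≤ ‖x‖ := fun x => by
    have h1 := Submodule.norm_sq_eq_add_norm_sq_starProjection x W
    rw [W.starProjection_orthogonal_val] at h1
    exact (sq_le_sq₀ (norm_nonneg _) (norm_nonneg _)).1 (by nlinarith [sq_nonneg ‖P x‖])
  have hPmem : ∀ x ∈ W, P x = x := fun x hx => Submodule.starProjection_eq_self_iff.2 hx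
  have hPmem' : ∀ x ∈ Wᗮ, P x = 0 := fun x hx =>
    (W.starProjection_apply_eq_zero_iff).2 hx
  obtain ⟨β, hβ, ⟨hβlt, hβle⟩, hβmin⟩ := hΓ.exists_min_norm
    (p := fun β => ‖β 0 - P (β 0)‖ < ‖P (β 0)‖ ∧ ‖linPart β - 1‖ ≤ (‖D‖ - c) / 8) (by
      obtain ⟨β, hβ, t, ht, h1, h2⟩ := hΓ.exists_near_direction u
        (ε := (‖D‖ - c) / 8) (by linarith)
      refine ⟨β, hβ, ?_, h2⟩
      have hε : (‖D‖ - c) / 8 ≤ 1 / 16 := by linarith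
      have h3 : (‖D‖ - c) / 8 * t ≤ 1 / 16 * t := mul_le_mul_of_nonneg_right hε ht.le
      have hPu : P (t • u) = t • u := hPmem _ (W.smul_mem _ huW)
      have h4 : β 0 - P (β 0) = (β 0 - t • u) - P (β 0 - t • u) := by
        rw [map_sub, hPu]; abel
      have h5 : ‖β 0 - P (β 0)‖ ≤ 1 / 16 * t := by
        rw [h4]; exact (hPsub _).trans (h1.trans h3)
      have h6 : t ≤ ‖P (β 0)‖ + 1 / 16 * t := by
        have e : t • u = P (β 0) - P (β 0 - t • u) := by rw [map_sub, hPu]; abel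
        calc t = ‖t • u‖ := by rw [norm_smul, hu, mul_one, Real.norm_of_nonneg ht.le]
          _ = ‖P (β 0) - P (β 0 - t • u)‖ := by rw [← e]
          _ ≤ ‖P (β 0)‖ + ‖P (β 0 - t • u)‖ := norm_sub_le _ _
          _ ≤ _ := by linarith [hPle (β 0 - t • u)]
      linarith)
  set b := β 0
  set κ := α * β * α⁻¹ * β⁻¹ with hκ
  have hκΓ : κ ∈ Γ := Γ.mul_mem (Γ.mul_mem (Γ.mul_mem hα hβ) (Γ.inv_mem hα)) (Γ.inv_mem hβ)
  have hκlin : ‖linPart κ - 1‖ ≤ ‖linPart β - 1‖ := by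
    refine (norm_linPart_commutator_sub_one_le α β).trans ?_
    have := mul_le_mul_of_nonneg_right hα2 (norm_nonneg (linPart β - 1))
    linarith
  set r := (1 - linPart κ) b + (1 - linPart α * linPart β * linPart α⁻¹) (α 0)
  have hκ0 : κ 0 = D b + r := commutator_apply_zero α β
  have hconj : ‖1 - linPart α * linPart β * linPart α⁻¹‖ ≤ ‖linPart β - 1‖ := by
    have e : 1 - linPart α * linPart β * linPart α⁻¹ =
        linPart α * ((1 - linPart β) * linPart α⁻¹) := by
      rw [sub_mul, mul_sub, one_mul, linPart_mul_inv, mul_assoc]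
    rw [e, norm_sub_rev (linPart β)]
    exact (norm_linPart_mul_le _ _).trans (norm_mul_linPart_le _ _)
  have hr : ‖r‖ ≤ ‖linPart β - 1‖ * (‖b‖ + ‖α 0‖) := by
    rw [mul_add]
    refine (norm_add_le _ _).trans (add_le_add ?_ ?_)
    · refine (ContinuousLinearMap.le_opNorm _ _).trans
        (mul_le_mul_of_nonneg_right ?_ (norm_nonneg _))
      rwa [norm_sub_rev]
    · exact (ContinuousLinearMap.le_opNorm _ _).trans
        (mul_le_mul_of_nonneg_right hconj (norm_nonneg _))
  -- If `β` is a translation the remainder vanishes; otherwise `β` competes with `α`, so minimality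
  -- gives `‖α 0‖ ≤ ‖b‖`.
  have hr2 : ‖r‖ ≤ (‖D‖ - c) / 4 * ‖b‖ := by
    by_cases hβ1 : linPart β = 1
    · rw [hβ1, sub_self, norm_zero, zero_mul] at hr
      exact hr.trans (mul_nonneg (by linarith) (norm_nonneg _))
    · have h1 : ‖α 0‖ ≤ ‖b‖ := hαmin β hβ ⟨by linarith, hβ1⟩
      have h2 : ‖linPart β - 1‖ * (‖b‖ + ‖α 0‖) ≤ (‖D‖ - c) / 8 * (‖b‖ + ‖b‖) :=
        mul_le_mul hβle (by linarith) (by positivity) (by linarith)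
      linarith
  have hbp : ‖b‖ < 2 * ‖P b‖ := by
    have : ‖b‖ ≤ ‖P b‖ + ‖b - P b‖ := by
      simpa using norm_add_le (P b) (b - P b)
    linarith
  have hqmem : b - P b ∈ Wᗮ := W.sub_starProjection_mem_orthogonal b
  have hpmem : P b ∈ W := W.starProjection_apply_mem b
  have hPD : P (D b) = D (P b) := by
    have e : D b = D (P b) + D (b - P b) := by rw [← map_add, add_sub_cancel]
    rw [e, map_add, hPmem _ (hDW _ hpmem), hPmem' _ (hDW' _ hqmem), add_zero]
  have hκP : P (κ 0) = D (P b) + P r := by rw [hκ0, map_add, hPD]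
  have hκQ : κ 0 - P (κ 0) = D (b - P b) + (r - P r) := by
    rw [hκP, hκ0, map_sub]; abel
  have h1 : ‖κ 0 - P (κ 0)‖ ≤ c * ‖b - P b‖ + ‖r‖ := by
    rw [hκQ]
    exact (norm_add_le _ _).trans (add_le_add (hW' _ hqmem) (hPsub r))
  have h2 : ‖D‖ * ‖P b‖ ≤ ‖P (κ 0)‖ + ‖r‖ := by
    rw [← hW _ hpmem]
    have e : D (P b) = P (κ 0) - P r := by rw [hκP]; abel
    rw [e]
    exact (norm_sub_le _ _).trans (add_le_add_right (hPle r) _)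
  have h3 : c * ‖b - P b‖ ≤ c * ‖P b‖ := mul_le_mul_of_nonneg_left hβlt.le hc0
  have h4 : (‖D‖ - c) / 4 * ‖b‖ < (‖D‖ - c) / 4 * (2 * ‖P b‖) :=
    mul_lt_mul_of_pos_left hbp (by linarith)
  -- `D` stretches the `W`-component by exactly `‖D‖` and the other component by at most `c`; the
  -- remainder is less than half the resulting gap `(‖D‖ - c) * ‖P b‖`.
  have hlt : ‖κ 0 - P (κ 0)‖ < ‖P (κ 0)‖ := by nlinarith
  have hb0 : 0 < ‖b‖ := ((norm_nonneg _).trans_lt hβlt).trans_le (hPle b)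
  have h5 : ‖κ 0‖ < ‖b‖ := by
    have e1 : ‖κ 0‖ ≤ ‖D‖ * ‖b‖ + ‖r‖ := by
      rw [hκ0]
      exact (norm_add_le _ _).trans (add_le_add_left (D.le_opNorm b) _)
    nlinarith
  exact (hβmin κ hκΓ ⟨hlt, hκlin.trans hβle⟩).not_gt h5

/-- Bieberbach: the translations in a space group span the whole space. -/
theorem IsSpaceGroup.span_translations (hΓ : IsSpaceGroup Γ) :
    Submodule.span ℝ {a : E n | ∃ τ ∈ Γ, linPart τ = 1 ∧ τ 0 = a} = ⊤ := by
  set W := Submodule.span ℝ {a : E n | ∃ τ ∈ Γ, linPart τ = 1 ∧ τ 0 = a} with hWdef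
  rw [← Submodule.orthogonal_eq_bot_iff, Submodule.eq_bot_iff]
  intro u hu
  by_contra hne
  have hu0 : 0 < ‖u‖ := norm_pos_iff.2 hne
  -- The bound `1 / 2` makes `β` a translation, hence orthogonal to `u`, while `‖u‖ / 2` keeps its
  -- vector too close to `t • u` for that.
  obtain ⟨β, hβ, t, ht, h1, h2⟩ := hΓ.exists_near_direction u
    (ε := min (1 / 2) (‖u‖ / 2)) (by positivity)
  have hlin := hΓ.linPart_eq_one hβ (h2.trans (min_le_left _ _))
  have hmem : β 0 ∈ W := Submodule.subset_span ⟨β, hβ, hlin, rfl⟩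
  have hin := W.inner_right_of_mem_orthogonal hmem hu
  have h3 : inner ℝ (β 0 - t • u) u = -(t * ‖u‖ ^ 2) := by
    rw [inner_sub_left, hin, inner_smul_left, real_inner_self_eq_norm_sq]
    simp
  have h4 := abs_real_inner_le_norm (β 0 - t • u) u
  rw [h3, abs_neg, abs_of_pos (by positivity)] at h4
  have h5 : min (1 / 2) (‖u‖ / 2) * t ≤ ‖u‖ / 2 * t :=
    mul_le_mul_of_nonneg_right (min_le_right _ _) ht.le
  nlinarith [mul_le_mul_of_nonneg_right (h1.trans h5) hu0.le, mul_pos ht (pow_pos hu0 2)]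

/-- Bieberbach: every element of a space group has a power which is a translation. -/
theorem IsSpaceGroup.exists_pow_linPart_eq_one (hΓ : IsSpaceGroup Γ) {γ : Isom n} (hγ : γ ∈ Γ) :
    ∃ k : ℕ, 0 < k ∧ linPart (γ ^ k) = 1 := by
  obtain ⟨A, -, φ, hφ, hA⟩ := (isCompact_closedBall (0 : E n →L[ℝ] E n) 1).tendsto_subseq
    (x := fun k => linPart (γ ^ k)) fun k => mem_closedBall_zero_iff.2 (norm_linPart_le _)
  obtain ⟨N, hN⟩ := Metric.cauchySeq_iff.1 hA.cauchySeq (1 / 2) (by norm_num)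
  have hlt : φ N < φ (N + 1) := hφ (Nat.lt_succ_self N)
  refine ⟨φ (N + 1) - φ N, Nat.sub_pos_of_lt hlt, hΓ.linPart_eq_one (Γ.pow_mem hγ _) ?_⟩
  rw [pow_sub γ hlt.le]
  refine (norm_linPart_mul_inv_sub_one_le _ _).trans ?_
  rw [← dist_eq_norm]
  exact (hN (N + 1) (Nat.le_succ N) N le_rfl).le

end Bieberbach

/-! ### Actions of the infinite dihedral group on the line -/

section DihedralLine

/-- The rotations of the infinite dihedral group. -/
def rot (k : ℤ) : DihedralGroup 0 := .r (Int.cast k)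

/-- The reflections of the infinite dihedral group. -/
def refl (k : ℤ) : DihedralGroup 0 := .sr (Int.cast k)

theorem rot_or_refl (g : DihedralGroup 0) : (∃ k, g = rot k) ∨ ∃ k, g = refl k := by
  rcases g with k | k
  · exact .inl ⟨k, congrArg DihedralGroup.r (Int.cast_id (n := k)).symm⟩
  · exact .inr ⟨k, congrArg DihedralGroup.sr (Int.cast_id (n := k)).symm⟩

theorem rot_mul_rot (k l : ℤ) : rot k * rot l = rot (k + l) := by simp [rot]

theorem rot_mul_refl (k l : ℤ) : rot k * refl l = refl (l - k) := by simp [rot, refl]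

theorem refl_mul_rot (k l : ℤ) : refl k * rot l = refl (k + l) := by simp [rot, refl]

theorem refl_mul_refl (k l : ℤ) : refl k * refl l = rot (l - k) := by simp [rot, refl]

theorem rot_zero : rot 0 = 1 := by simp [rot]

theorem inv_rot (k : ℤ) : (rot k)⁻¹ = rot (-k) := by simp [rot]

theorem inv_refl (k : ℤ) : (refl k)⁻¹ = refl k := by simp [refl]

theorem rot_pow (k : ℤ) (m : ℕ) : rot k ^ m = rot (k * m) := by simp [rot]

theorem rot_zpow (k m : ℤ) : rot k ^ m = rot (k * m) := by simp [rot]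

theorem rot_injective : Function.Injective rot := fun _ _ h =>
  Int.cast_injective (α := ℤ) (DihedralGroup.r.inj h)

theorem refl_injective : Function.Injective refl := fun _ _ h =>
  Int.cast_injective (α := ℤ) (DihedralGroup.sr.inj h)

theorem rot_ne_refl (k l : ℤ) : rot k ≠ refl l := nofun

theorem rot_eq_one_iff {k : ℤ} : rot k = 1 ↔ k = 0 := by
  rw [← rot_zero, rot_injective.eq_iff]

theorem refl_ne_one (k : ℤ) : refl k ≠ 1 := by
  rw [← rot_zero]; exact (rot_ne_refl 0 k).symm

/-- The standard action of the infinite dihedral group on the line, with translation length `a`. -/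
noncomputable def dihedralLine (a : ℝ) : DihedralGroup 0 → ℝ → ℝ
  | .r k, x => x + a * (Int.cast (R := ℝ) k)
  | .sr k, x => -x - a * (Int.cast (R := ℝ) k)

theorem dihedralLine_rot (a : ℝ) (k : ℤ) (x : ℝ) : dihedralLine a (rot k) x = x + a * k := rfl

theorem dihedralLine_refl (a : ℝ) (k : ℤ) (x : ℝ) : dihedralLine a (refl k) x = -x - a * k := rfl

/-- An action of the infinite dihedral group on the line by isometries in which some power of the
rotation generator acts as a nontrivial translation is standard, up to a change of coordinate. -/
theorem exists_dihedralLine_coordinate (ρ : DihedralGroup 0 →* Equiv.Perm ℝ)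
    (hρ : ∀ g, ∃ s c : ℝ, (s = 1 ∨ s = -1) ∧ ∀ x, ρ g x = s * x + c)
    {k : ℕ} {c : ℝ} (hc : c ≠ 0) (hk : ∀ x, ρ (rot 1 ^ k) x = x + c) :
    ∃ (ψ : ℝ ≃ᵢ ℝ) (a : ℝ), 0 < a ∧ ∀ g x, ψ (ρ g x) = dihedralLine a g (ψ x) := by
  obtain ⟨s, a, hs, hr⟩ := hρ (rot 1)
  -- A reflection has trivial square, but a power of `rot 1` is a nontrivial translation.
  have hs1 : s = 1 := by
    refine hs.resolve_right fun hs => ?_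
    have h2 : ρ (rot 1) ^ 2 = 1 := by
      ext x
      rw [pow_two, Equiv.Perm.mul_apply, hr, hr, hs, Equiv.Perm.one_apply]
      ring
    have h3 : ρ (rot 1 ^ k) ^ 2 = 1 := by
      rw [map_pow, ← pow_mul, mul_comm, pow_mul, h2, one_pow]
    have h4 := congrArg (fun p : Equiv.Perm ℝ => p 0) h3
    rw [pow_two, Equiv.Perm.mul_apply, hk, hk, Equiv.Perm.one_apply] at h4
    exact hc (by linarith)
  subst hs1
  have hr1 : ρ (rot 1) = Equiv.addRight a := by
    ext x; rw [hr, one_mul]; rfl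
  have hrz : ∀ (k : ℤ) x, ρ (rot k) x = x + k * a := fun k x => by
    have hnat : ∀ (m : ℕ) x, ρ (rot m) x = x + m * a := fun m => by
      induction m with
      | zero => intro x; simp [rot_zero]
      | succ m ih =>
        intro x
        rw [Nat.cast_succ, ← rot_mul_rot, map_mul, Equiv.Perm.mul_apply, hr, ih]
        push_cast
        ring
    obtain ⟨m, rfl | rfl⟩ := k.eq_nat_or_neg
    · simpa using hnat m x
    · rw [← inv_rot, map_inv, Equiv.Perm.inv_eq_iff_eq, hnat]
      push_cast
      ring
  have ha : a ≠ 0 := by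
    rintro rfl
    refine hc ?_
    have := hk 0
    rw [map_pow, hr1] at this
    simpa using this.symm
  obtain ⟨s, c', hs, hsr⟩ := hρ (refl 0)
  -- A translation would commute with `rot 1`, whereas `refl 0` inverts it.
  have hs1 : s = -1 := by
    refine hs.resolve_left fun hs => ?_
    subst hs
    have h1 : refl 0 * rot 1 = rot (-1) * refl 0 := by
      rw [refl_mul_rot, rot_mul_refl]; norm_num
    have h2 := congrArg (fun g => ρ g 0) h1
    simp only [map_mul, Equiv.Perm.mul_apply] at h2
    rw [hsr, hsr, hr] at h2
    have h3 := hrz (-1) (1 * 0 + c')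
    push_cast at h3
    rw [h3] at h2
    exact ha (by linarith)
  subst hs1
  have hsrz : ∀ (k : ℤ) x, ρ (refl k) x = -x - k * a + c' := fun k x => by
    have h1 : refl k = refl 0 * rot k := by rw [refl_mul_rot, zero_add]
    rw [h1, map_mul, Equiv.Perm.mul_apply, hsr, hrz]
    ring
  -- Move the origin to the fixed point `c' / 2` of `refl 0`, and reverse the line if the
  -- translation length is negative.
  rcases ha.lt_or_gt with h | h
  · refine ⟨(IsometryEquiv.subRight (c' / 2)).trans (IsometryEquiv.neg ℝ), -a, by linarith,
      fun g x => ?_⟩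
    obtain ⟨k, rfl⟩ | ⟨k, rfl⟩ := rot_or_refl g
    · rw [hrz, dihedralLine_rot]
      simp only [IsometryEquiv.trans_apply, IsometryEquiv.subRight_apply, IsometryEquiv.neg_apply]
      ring
    · rw [hsrz, dihedralLine_refl]
      simp only [IsometryEquiv.trans_apply, IsometryEquiv.subRight_apply, IsometryEquiv.neg_apply]
      ring
  · refine ⟨IsometryEquiv.subRight (c' / 2), a, h, fun g x => ?_⟩
    obtain ⟨k, rfl⟩ | ⟨k, rfl⟩ := rot_or_refl g
    · rw [hrz, dihedralLine_rot]
      simp only [IsometryEquiv.subRight_apply]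
      ring
    · rw [hsrz, dihedralLine_refl]
      simp only [IsometryEquiv.subRight_apply]
      ring

end DihedralLine

/-! ### Translations -/

section Translations

variable {n : ℕ} {Γ : Subgroup (Isom n)}

/-- The embedding of the translations in the isometry group. -/
noncomputable def translationHom (n : ℕ) : Multiplicative (E n) →* Isom n where
  toFun a := AffineIsometryEquiv.constVAdd ℝ (E n) a.toAdd
  map_one' := by ext1 x; simp
  map_mul' a b := by ext1 x; simp [add_assoc]

/-- The vectors of the translations in a group of isometries. -/
noncomputable def translationLattice (H : Subgroup (Isom n)) : AddSubgroup (E n) where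
  carrier := {a | translationHom n (.ofAdd a) ∈ H}
  zero_mem' := by simp
  add_mem' ha hb := by simpa using H.mul_mem ha hb
  neg_mem' ha := by simpa using H.inv_mem ha

theorem mem_translationLattice {H : Subgroup (Isom n)} {a : E n} :
    a ∈ translationLattice H ↔ translationHom n (.ofAdd a) ∈ H := Iff.rfl

theorem translationHom_apply (a x : E n) : translationHom n (.ofAdd a) x = a + x := rfl

theorem linPart_translationHom (a : E n) : linPart (translationHom n (.ofAdd a)) = 1 := by
  ext1 x
  have h := isom_apply (translationHom n (.ofAdd a)) x
  rw [translationHom_apply, translationHom_apply, add_zero, add_comm] at h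
  exact (add_right_cancel h).symm

theorem eq_translationHom {τ : Isom n} (h : linPart τ = 1) :
    τ = translationHom n (.ofAdd (τ 0)) :=
  isom_ext (by rw [h, linPart_translationHom]) (by rw [translationHom_apply, add_zero])

theorem spanOf_eq_span_translationLattice (N : Subgroup Γ) :
    spanOf N = Submodule.span ℝ (translationLattice (N.map Γ.subtype) : Set (E n)) := by
  refine congrArg (Submodule.span ℝ) (Set.ext fun a => ?_)
  rw [SetLike.mem_coe, mem_translationLattice, Subgroup.mem_map]
  rfl

theorem apply_zero_mem_spanOf {N : Subgroup Γ} {ν : Γ} (hν : ν ∈ N)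
    (h : linPart (ν : Isom n) = 1) : (ν : Isom n) 0 ∈ spanOf N :=
  Submodule.subset_span ⟨ν, hν, eq_translationHom h⟩

theorem IsSpaceGroup.span_translationLattice (hΓ : IsSpaceGroup Γ) :
    Submodule.span ℝ (translationLattice Γ : Set (E n)) = ⊤ := by
  rw [← hΓ.span_translations]
  refine congrArg (Submodule.span ℝ) (Set.ext fun a => ⟨fun h => ⟨_, h, linPart_translationHom a, ?_⟩, ?_⟩)
  · rw [translationHom_apply, add_zero]
  · rintro ⟨τ, hτ, hlin, rfl⟩
    rw [SetLike.mem_coe, mem_translationLattice, ← eq_translationHom hlin]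
    exact hτ

/-- A lattice vector in the span of a sublattice has a multiple in the sublattice. -/
theorem IsSpaceGroup.exists_nsmul_mem (hΓ : IsSpaceGroup Γ) {L : AddSubgroup (E n)}
    (hL : L ≤ translationLattice Γ) {a : E n} (ha : a ∈ translationLattice Γ)
    (haL : a ∈ Submodule.span ℝ (L : Set (E n))) : ∃ k : ℕ, 0 < k ∧ k • a ∈ L := by
  obtain ⟨m, c, b, hcb⟩ := Submodule.mem_span_set'.1 haL
  -- Pigeonhole: subtracting the integer parts of the coefficients of `k • a` leaves a lattice
  -- vector of bounded norm, so two multiples leave the same vector and differ by an element of `L`.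
  let v : ℕ → E n := fun k => ∑ i, ⌊k * c i⌋ • (b i : E n)
  have hv : ∀ k, v k ∈ L := fun k => L.sum_mem fun i _ => L.zsmul_mem (b i).2 _
  have hfin : {x | x ∈ translationLattice Γ ∧ ‖x‖ ≤ ∑ i, ‖(b i : E n)‖}.Finite := by
    refine ((hΓ.finite_norm_le (∑ i, ‖(b i : E n)‖)).image fun γ => γ 0).subset ?_
    rintro x ⟨hx, hx2⟩
    have e : translationHom n (.ofAdd x) 0 = x := by rw [translationHom_apply, add_zero]
    exact ⟨translationHom n (.ofAdd x), ⟨hx, by rwa [e]⟩, e⟩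
  have hmaps : ∀ k : ℕ, k • a - v k ∈
      {x | x ∈ translationLattice Γ ∧ ‖x‖ ≤ ∑ i, ‖(b i : E n)‖} := fun k => by
    refine ⟨AddSubgroup.sub_mem _ (AddSubgroup.nsmul_mem _ ha k) (hL (hv k)), ?_⟩
    have e : k • a - v k = ∑ i, Int.fract (k * c i) • (b i : E n) := by
      rw [← hcb, Finset.smul_sum, ← Finset.sum_sub_distrib]
      refine Finset.sum_congr rfl fun i _ => ?_
      rw [← Int.self_sub_floor, sub_smul, mul_smul, Nat.cast_smul_eq_nsmul, Int.cast_smul_eq_zsmul]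
    rw [e]
    refine (norm_sum_le _ _).trans (Finset.sum_le_sum fun i _ => ?_)
    rw [norm_smul, Real.norm_of_nonneg (Int.fract_nonneg _)]
    exact mul_le_of_le_one_left (norm_nonneg _) (Int.fract_lt_one _).le
  obtain ⟨k, -, l, -, hkl, h⟩ := Set.infinite_univ.exists_lt_map_eq_of_mapsTo
    (fun k _ => hmaps k) hfin
  refine ⟨l - k, Nat.sub_pos_of_lt hkl, ?_⟩
  have e : (l - k) • a = v l - v k := by
    have e1 : l • a = (l - k) • a + k • a := by rw [← add_smul, Nat.sub_add_cancel hkl.le]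
    have h' : k • a - v k = l • a - v l := h
    rw [e1] at h'
    have : (l - k) • a + (k • a - v k) - (k • a - v k) = v l - v k := by
      nth_rw 2 [h']; abel
    simpa using this
  rw [e]
  exact L.sub_mem (hv l) (hv k)

end Translations

/-! ### The action of `Γ` on the line `Vᗮ` -/

section LineCoordinate

variable {n : ℕ} {Γ : Subgroup (Isom n)} (N : Subgroup Γ) [N.Normal]

theorem perpAction_eq (γ : Γ) (w : ((spanOf N)ᗮ : Submodule ℝ (E n))) :
    perpAction N γ w = (spanOf N)ᗮ.orthogonalProjectionOnto (linPart (γ : Isom n) w) +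
      (spanOf N)ᗮ.orthogonalProjectionOnto ((γ : Isom n) 0) := by
  rw [← map_add, ← isom_apply]
  exact projAction_apply _ _ _ _

theorem perpAction_of_linPart_eq_one {τ : Γ} (hτ : linPart (τ : Isom n) = 1)
    (w : ((spanOf N)ᗮ : Submodule ℝ (E n))) :
    perpAction N τ w = w + (spanOf N)ᗮ.orthogonalProjectionOnto ((τ : Isom n) 0) := by
  rw [perpAction_eq, hτ, one_apply_eq_self,
    Submodule.orthogonalProjectionOnto_mem_subspace_eq_self]

theorem perpAction_eq_one_of_mem {ν : Γ} (hν : ν ∈ N) (h : linPart (ν : Isom n) = 1) :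
    perpAction N ν = 1 := by
  ext1 w
  rw [perpAction_of_linPart_eq_one N h, Submodule.orthogonalProjectionOnto_eq_zero_iff.2, add_zero,
    Equiv.Perm.one_apply]
  exact Submodule.le_orthogonal_orthogonal _ (apply_zero_mem_spanOf hν h)

theorem perpAction_affine (φ : ((spanOf N)ᗮ : Submodule ℝ (E n)) ≃ₗᵢ[ℝ] ℝ) (γ : Γ) :
    ∃ s c : ℝ, (s = 1 ∨ s = -1) ∧ ∀ w, φ (perpAction N γ w) = s * φ w + c := by
  let M : ((spanOf N)ᗮ : Submodule ℝ (E n)) →ₗ[ℝ] ℝ := φ.toLinearEquiv.toLinearMap ∘ₗ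
    (spanOf N)ᗮ.orthogonalProjectionOnto.toLinearMap ∘ₗ (linPart (γ : Isom n)).toLinearMap ∘ₗ
      (spanOf N)ᗮ.subtype
  refine ⟨M (φ.symm 1), φ ((spanOf N)ᗮ.orthogonalProjectionOnto ((γ : Isom n) 0)), ?_,
    fun w => ?_⟩
  · rw [← abs_eq zero_le_one, ← Real.norm_eq_abs]
    have hmem := linear_mem_spanOf_orthogonal N γ (φ.symm 1).2
    have h1 : (spanOf N)ᗮ.orthogonalProjectionOnto (linPart (γ : Isom n) (φ.symm 1 : E n)) =
        ⟨linPart (γ : Isom n) (φ.symm 1 : E n), hmem⟩ :=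
      Submodule.orthogonalProjectionOnto_mem_subspace_eq_self
        (⟨_, hmem⟩ : ((spanOf N)ᗮ : Submodule ℝ (E n)))
    calc ‖M (φ.symm 1)‖ = ‖φ ((spanOf N)ᗮ.orthogonalProjectionOnto
          (linPart (γ : Isom n) (φ.symm 1 : E n)))‖ := rfl
      _ = ‖linPart (γ : Isom n) (φ.symm 1 : E n)‖ := by rw [φ.norm_map, h1]; rfl
      _ = ‖φ.symm 1‖ := norm_linPart_apply _ _
      _ = 1 := by rw [φ.symm.norm_map, norm_one]
  · have h1 : w = φ w • φ.symm 1 := by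
      rw [← map_smul, smul_eq_mul, mul_one, φ.symm_apply_apply]
    have h2 : M w = M (φ.symm 1) * φ w := by
      conv_lhs => rw [h1]
      rw [map_smul, smul_eq_mul, mul_comm]
    rw [perpAction_eq, map_add, ← h2]
    rfl

/-- If `Γ` contains a translation outside the span of `N` and `Vᗮ` is a line, then `N` acts trivially
on `Vᗮ`. -/
theorem perpAction_eq_one (hΓ : IsSpaceGroup Γ)
    (φ : ((spanOf N)ᗮ : Submodule ℝ (E n)) ≃ₗᵢ[ℝ] ℝ) {τ : Γ} (hτ : linPart (τ : Isom n) = 1)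
    (hτ0 : (τ : Isom n) 0 ∉ spanOf N) {ν : Γ} (hν : ν ∈ N) : perpAction N ν = 1 := by
  obtain ⟨s, c, hs, hsc⟩ := perpAction_affine N φ ν
  have hw0 : φ ((spanOf N)ᗮ.orthogonalProjectionOnto ((τ : Isom n) 0)) ≠ 0 := by
    rw [Ne, LinearIsometryEquiv.map_eq_zero_iff, Submodule.orthogonalProjectionOnto_eq_zero_iff,
      Submodule.orthogonal_orthogonal]
    exact hτ0
  set t := φ ((spanOf N)ᗮ.orthogonalProjectionOnto ((τ : Isom n) 0))
  have hτφ : ∀ w, φ (perpAction N τ w) = φ w + t := fun w => by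
    rw [perpAction_of_linPart_eq_one N hτ, map_add]
  -- The commutator of `ν` with the translation `τ` is a translation in `N`, hence trivial on `Vᗮ`.
  -- So `ν` commutes there with a nontrivial translation and cannot be a reflection.
  have hs1 : s = 1 := by
    have hκN : ν * τ * ν⁻¹ * τ⁻¹ ∈ N := by
      have : ν * τ * ν⁻¹ * τ⁻¹ = ν * (τ * ν⁻¹ * τ⁻¹) := by group
      rw [this]
      exact N.mul_mem hν (Subgroup.Normal.conj_mem ‹_› _ (N.inv_mem hν) τ)
    have hτi : linPart (τ : Isom n)⁻¹ = 1 := by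
      have := linPart_mul_inv (τ : Isom n)
      rwa [hτ, one_mul] at this
    have hκlin : linPart ((ν * τ * ν⁻¹ * τ⁻¹ : Γ) : Isom n) = 1 := by
      push_cast
      rw [linPart_mul, linPart_mul, linPart_mul, hτ, hτi, mul_one, mul_one, linPart_mul_inv]
    have h1 := perpAction_eq_one_of_mem N hκN hκlin
    have h2 : perpAction N ν * perpAction N τ = perpAction N τ * perpAction N ν := by
      rw [map_mul, map_mul, map_mul, map_inv, map_inv] at h1
      exact (mul_inv_eq_iff_eq_mul.1 (mul_inv_eq_one.1 h1))
    have h3 := congrArg (fun p : Equiv.Perm _ => φ (p 0)) h2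
    simp only [Equiv.Perm.mul_apply] at h3
    rw [hsc, hτφ, hτφ, hsc] at h3
    have h4 : (s - 1) * t = 0 := by linarith
    exact sub_eq_zero.1 ((mul_eq_zero.1 h4).resolve_right hw0)
  subst hs1
  -- Now `ν` shifts the line by `c`, and some positive power of it is a translation in `N`, which
  -- shifts by 0.
  obtain ⟨k, hk, hlin⟩ := hΓ.exists_pow_linPart_eq_one ν.2
  have h1 := perpAction_eq_one_of_mem N (ν := ν ^ k) (N.pow_mem hν k) (by exact_mod_cast hlin)
  have h2 : ∀ (k : ℕ) w, φ (perpAction N (ν ^ k) w) = φ w + k * c := fun k => by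
    induction k with
    | zero => intro w; simp
    | succ k ih =>
      intro w
      rw [pow_succ, map_mul, Equiv.Perm.mul_apply, ih, hsc]
      push_cast
      ring
  have h3 := h2 k 0
  rw [h1, Equiv.Perm.one_apply] at h3
  have hc : c = 0 := by
    have : (k : ℝ) * c = 0 := by linarith
    exact (mul_eq_zero.1 this).resolve_left (by exact_mod_cast hk.ne')
  ext1 w
  refine φ.injective ?_
  rw [hsc, hc, Equiv.Perm.one_apply]
  ring

theorem rot_sq_eq (g : DihedralGroup 0) : ∃ l : ℤ, g ^ 2 = rot l := by
  obtain ⟨k, rfl⟩ | ⟨k, rfl⟩ := rot_or_refl g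
  · exact ⟨_, rot_pow k 2⟩
  · exact ⟨0, by rw [pow_two, refl_mul_refl, sub_self]⟩

theorem linearIsometryEquiv_real_of_span {P : Type*} [NormedAddCommGroup P]
    [InnerProductSpace ℝ P] {w₀ : P} (h0 : w₀ ≠ 0) (h : ∀ w, ∃ c : ℝ, c • w₀ = w) :
    Nonempty (P ≃ₗᵢ[ℝ] ℝ) := by
  have hfin : Module.finrank ℝ P = 1 := (finrank_eq_one_iff_of_nonzero' w₀ h0).2 h
  have : FiniteDimensional ℝ P := Module.finite_of_finrank_eq_succ hfin
  exact ⟨((stdOrthonormalBasis ℝ P).reindex (finCongr hfin)).equiv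
    (OrthonormalBasis.singleton (Fin 1) ℝ) (Equiv.refl _)⟩

/-- If `Γ/N` is infinite dihedral, then it acts on the line `Vᗮ` in the standard way. -/
theorem exists_line_coordinate (hΓ : IsSpaceGroup Γ) (e : Γ ⧸ N ≃* DihedralGroup 0) :
    ∃ (φ : ((spanOf N)ᗮ : Submodule ℝ (E n)) ≃ᵢ ℝ) (a : ℝ), 0 < a ∧
      ∀ (γ : Γ) w, φ (perpAction N γ w) = dihedralLine a (e γ) (φ w) := by
  obtain ⟨γ₁, hγ₁⟩ := QuotientGroup.mk_surjective (e.symm (rot 1))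
  have hγ₁e : e (γ₁ : Γ ⧸ N) = rot 1 := by rw [hγ₁, e.apply_symm_apply]
  have he : ∀ γ : Γ, e γ = 1 ↔ γ ∈ N := fun γ => by
    rw [map_eq_one_iff e e.injective, QuotientGroup.eq_one_iff]
  obtain ⟨k, hk, hlin⟩ := hΓ.exists_pow_linPart_eq_one γ₁.2
  set τ := γ₁ ^ k with hτ
  have hτlin : linPart (τ : Isom n) = 1 := by exact_mod_cast hlin
  have hτe : e (τ : Γ ⧸ N) = rot k := by
    rw [hτ, QuotientGroup.mk_pow, map_pow, hγ₁e, rot_pow, one_mul]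
  have hτT : translationHom n (.ofAdd ((τ : Isom n) 0)) = τ := (eq_translationHom hτlin).symm
  set t₀ := (τ : Isom n) 0
  have hmemN : ∀ {a : E n} {ν : Γ}, translationHom n (.ofAdd a) = ν →
      (a ∈ translationLattice (N.map Γ.subtype) ↔ ν ∈ N) := fun {a ν} h => by
    rw [mem_translationLattice, h]
    exact Subgroup.mem_map_iff_mem Γ.subtype_injective
  have hsmul : ∀ (l : ℤ), translationHom n (.ofAdd (l • t₀)) = ((τ ^ l : Γ) : Isom n) := fun l => by
    rw [ofAdd_zsmul, map_zpow, hτT, Subgroup.coe_zpow]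
  -- Otherwise a positive power of `τ` would lie in `N`, although `τ` maps to a rotation of infinite
  -- order.
  have ht₀ : t₀ ∉ spanOf N := fun h => by
    rw [spanOf_eq_span_translationLattice] at h
    obtain ⟨l, hl, hmem⟩ := hΓ.exists_nsmul_mem (L := translationLattice (N.map Γ.subtype))
      (fun a ha => Subgroup.map_subtype_le N ha)
      (a := t₀) (by rw [mem_translationLattice, hτT]; exact τ.2) h
    rw [← natCast_zsmul, hmemN (hsmul l), ← he, QuotientGroup.mk_zpow, map_zpow, hτe, rot_zpow,
      rot_eq_one_iff] at hmem
    have : (k : ℤ) * l ≠ 0 := by positivity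
    exact this hmem
  have htop : spanOf N ⊔ Submodule.span ℝ {t₀} = ⊤ := by
    rw [eq_top_iff, ← hΓ.span_translationLattice, Submodule.span_le]
    intro a ha
    obtain ⟨σ, hσ⟩ : ∃ σ : Γ, translationHom n (.ofAdd a) = σ := ⟨⟨_, ha⟩, rfl⟩
    obtain ⟨l, hl⟩ := rot_sq_eq (e σ)
    -- Squaring turns the image of `σ` into a rotation `rot l`, so `σ ^ (2 * k)` and `τ ^ l` both
    -- map to `rot (k * l)` and their quotient is a translation in `N`.
    have hmem : (2 * k) • a + (-l) • t₀ ∈ spanOf N := by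
      rw [spanOf_eq_span_translationLattice]
      refine Submodule.subset_span ((hmemN (ν := σ ^ (2 * k) * τ ^ (-l)) ?_).2 ?_)
      · rw [ofAdd_add, map_mul, hsmul, ofAdd_nsmul, map_pow, hσ]
        rfl
      · rw [← he, QuotientGroup.mk_mul, map_mul, QuotientGroup.mk_pow, QuotientGroup.mk_zpow,
          map_pow, map_zpow, pow_mul, hl, hτe, rot_pow, rot_zpow, rot_mul_rot, rot_eq_one_iff]
        ring
    have h2k : ((2 * k : ℕ) : ℝ) ≠ 0 := by positivity
    have h1 : ((2 * k : ℕ) : ℝ) • a ∈ spanOf N ⊔ Submodule.span ℝ {t₀} := by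
      have e1 : ((2 * k : ℕ) : ℝ) • a = ((2 * k) • a + (-l) • t₀) + l • t₀ := by
        rw [neg_smul, neg_add_cancel_right, Nat.cast_smul_eq_nsmul]
      rw [e1]
      refine Submodule.add_mem_sup hmem ?_
      rw [← Int.cast_smul_eq_zsmul ℝ]
      exact Submodule.smul_mem _ _ (Submodule.mem_span_singleton_self t₀)
    have h2 := Submodule.smul_mem _ (((2 * k : ℕ) : ℝ)⁻¹) h1
    rwa [smul_smul, inv_mul_cancel₀ h2k, one_smul] at h2
  set w₀ := (spanOf N)ᗮ.orthogonalProjectionOnto t₀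
  have hw₀ : w₀ ≠ 0 := by
    rw [Ne, Submodule.orthogonalProjectionOnto_eq_zero_iff, Submodule.orthogonal_orthogonal]
    exact ht₀
  have hspan : ∀ w : ((spanOf N)ᗮ : Submodule ℝ (E n)), ∃ c : ℝ, c • w₀ = w := fun w => by
    obtain ⟨v, hv, y, hy, hvy⟩ := Submodule.mem_sup.1 (htop ▸ Submodule.mem_top (x := (w : E n)))
    obtain ⟨c, rfl⟩ := Submodule.mem_span_singleton.1 hy
    refine ⟨c, ?_⟩
    have h1 := Submodule.orthogonalProjectionOnto_mem_subspace_eq_self w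
    rw [← hvy, map_add, map_smul, Submodule.orthogonalProjectionOnto_eq_zero_iff.2
      (Submodule.le_orthogonal_orthogonal _ hv), zero_add] at h1
    exact h1
  obtain ⟨φ⟩ := linearIsometryEquiv_real_of_span hw₀ hspan
  have hN1 : ∀ ν ∈ N, ((φ.toEquiv.permCongrHom.toMonoidHom).comp (perpAction N)) ν = 1 :=
    fun ν hν => by
      rw [MonoidHom.comp_apply, perpAction_eq_one N hΓ φ hτlin ht₀ hν, map_one]
  let ρ : DihedralGroup 0 →* Equiv.Perm ℝ := (QuotientGroup.lift N _ hN1).comp e.symm.toMonoidHom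
  have hρ : ∀ (γ : Γ) x, ρ (e γ) x = φ (perpAction N γ (φ.symm x)) := fun γ x => by
    change QuotientGroup.lift N _ hN1 (e.symm (e γ)) x = _
    rw [e.symm_apply_apply]
    rfl
  obtain ⟨ψ, a, ha, hψ⟩ := exists_dihedralLine_coordinate ρ (k := k) (c := φ w₀)
    (fun g => by
      obtain ⟨γ, hγ⟩ := QuotientGroup.mk_surjective (e.symm g)
      obtain ⟨s, c, hs, hsc⟩ := perpAction_affine N φ γ
      refine ⟨s, c, hs, fun x => ?_⟩
      have hg : g = e γ := by rw [hγ, e.apply_symm_apply]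
      rw [hg, hρ, hsc, φ.apply_symm_apply])
    (by rwa [Ne, LinearIsometryEquiv.map_eq_zero_iff])
    (fun x => by
      rw [rot_pow, one_mul, ← hτe, hρ, perpAction_of_linPart_eq_one N hτlin, map_add,
        φ.apply_symm_apply])
  refine ⟨φ.toIsometryEquiv.trans ψ, a, ha, fun γ w => ?_⟩
  have h := hψ (e γ) (φ w)
  rw [hρ, φ.symm_apply_apply] at h
  exact h

/-- Such an element fixes `V` pointwise as a member of `K`, and `Vᗮ` pointwise as a member of `N`.
This is what makes `K` embed in `Γ/N`. -/
theorem eq_one_of_mem_actionKernel (hΓ : IsSpaceGroup Γ) (e : Γ ⧸ N ≃* DihedralGroup 0) {κ : Γ}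
    (hκ : κ ∈ actionKernel N) (hκN : κ ∈ N) : κ = 1 := by
  obtain ⟨φ, a, -, h⟩ := exists_line_coordinate N hΓ e
  have hperp : ∀ w, perpAction N κ w = w := fun w => φ.injective (by
    rw [h, (QuotientGroup.eq_one_iff κ).2 hκN, map_one, ← rot_zero, dihedralLine_rot]
    simp)
  have hspan : ∀ v, spanAction N κ v = v := fun v => by
    have := MonoidHom.mem_ker.1 hκ
    rw [this, Equiv.Perm.one_apply]
  have hproj : ∀ (x y : E n), (spanOf N).orthogonalProjectionOnto x =
      (spanOf N).orthogonalProjectionOnto y → (spanOf N)ᗮ.orthogonalProjectionOnto x =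
      (spanOf N)ᗮ.orthogonalProjectionOnto y → x = y := fun x y h1 h2 => by
    rw [← sub_eq_zero, ← map_sub, Submodule.orthogonalProjectionOnto_eq_zero_iff] at h1 h2
    rw [Submodule.orthogonal_orthogonal] at h2
    exact sub_eq_zero.1 ((Submodule.disjoint_def.1 (spanOf N).orthogonal_disjoint) _ h2 h1)
  have hκ0 : (κ : Isom n) 0 = 0 := hproj _ _ ((hspan 0).trans (map_zero _).symm)
    ((hperp 0).trans (map_zero _).symm)
  have hlin : ∀ x, (κ : Isom n) x = linPart (κ : Isom n) x := fun x => by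
    rw [isom_apply, hκ0, add_zero]
  refine Subtype.ext (isom_ext ?_ (by rw [hκ0]; rfl))
  have hW : ∀ (W : Submodule ℝ (E n)) (w : W), linPart (κ : Isom n) w ∈ W →
      W.orthogonalProjectionOnto ((κ : Isom n) w) = w → linPart (κ : Isom n) w = w := by
    intro W w hmem h
    rw [hlin, Submodule.orthogonalProjectionOnto_mem_subspace_eq_self (⟨_, hmem⟩ : W)] at h
    exact congrArg Subtype.val h
  ext1 x
  obtain ⟨v, hv, w, hw, rfl⟩ := (spanOf N).exists_add_mem_mem_orthogonal x
  rw [map_add, hW (spanOf N) ⟨v, hv⟩ (linear_mem_spanOf N κ hv) (hspan ⟨v, hv⟩),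
    hW (spanOf N)ᗮ ⟨w, hw⟩ (linear_mem_spanOf_orthogonal N κ hw) (hperp ⟨w, hw⟩)]
  rfl

end LineCoordinate

/-! ### Normal subgroups and Coxeter generators of the infinite dihedral group -/

section DihedralSubgroups

/-- The subgroup of the rotations `rot j` with `d ∣ j` and the reflections `refl j` with
`d ∣ j - c`. -/
def reflectionSubgroup (d c : ℤ) : Subgroup (DihedralGroup 0) where
  carrier := {g | (∃ j, d ∣ j ∧ g = rot j) ∨ ∃ j, d ∣ j - c ∧ g = refl j}
  one_mem' := .inl ⟨0, dvd_zero d, rot_zero.symm⟩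
  mul_mem' := by
    rintro _ _ (⟨i, hi, rfl⟩ | ⟨i, hi, rfl⟩) (⟨j, hj, rfl⟩ | ⟨j, hj, rfl⟩)
    · exact .inl ⟨_, dvd_add hi hj, rot_mul_rot i j⟩
    · exact .inr ⟨j - i, sub_right_comm j c i ▸ dvd_sub hj hi, rot_mul_refl i j⟩
    · exact .inr ⟨i + j, sub_add_eq_add_sub i c j ▸ dvd_add hi hj, refl_mul_rot i j⟩
    · exact .inl ⟨j - i, sub_sub_sub_cancel_right j i c ▸ dvd_sub hj hi, refl_mul_refl i j⟩
  inv_mem' := by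
    rintro _ (⟨i, hi, rfl⟩ | ⟨i, hi, rfl⟩)
    · exact .inl ⟨_, (dvd_neg (a := d)).2 hi, inv_rot i⟩
    · exact .inr ⟨i, hi, inv_refl i⟩

theorem rot_mem_of_rot_one_mem {H : Subgroup (DihedralGroup 0)} (h : rot 1 ∈ H) (k : ℤ) :
    rot k ∈ H := by
  have := H.zpow_mem h k
  rwa [rot_zpow, one_mul] at this

theorem eq_top_of_rot_one_mem {H : Subgroup (DihedralGroup 0)} (h : rot 1 ∈ H) {c : ℤ}
    (hc : refl c ∈ H) : H = ⊤ := by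
  refine (Subgroup.eq_top_iff' H).2 fun g => ?_
  obtain ⟨k, rfl⟩ | ⟨k, rfl⟩ := rot_or_refl g
  · exact rot_mem_of_rot_one_mem h k
  · have := H.mul_mem hc (rot_mem_of_rot_one_mem h (k - c))
    rwa [refl_mul_rot, add_sub_cancel] at this

theorem orderOf_refl (k : ℤ) : orderOf (refl k) = 2 := DihedralGroup.orderOf_sr _

theorem exists_eq_refl_of_orderOf {g : DihedralGroup 0} (h : orderOf g = 2) : ∃ k, g = refl k := by
  refine (rot_or_refl g).resolve_left ?_
  rintro ⟨k, rfl⟩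
  have h1 := pow_orderOf_eq_one (rot k)
  rw [h, rot_pow, rot_eq_one_iff] at h1
  have hk : k = 0 := by
    push_cast at h1
    omega
  rw [hk, rot_zero, orderOf_one] at h
  omega

theorem isCoxeterGenerators_iff {g h : DihedralGroup 0} :
    IsCoxeterGenerators g h ↔ ∃ k l, (l = k + 1 ∨ l = k - 1) ∧ g = refl k ∧ h = refl l := by
  constructor
  · rintro ⟨hg, hh, htop⟩
    obtain ⟨k, rfl⟩ := exists_eq_refl_of_orderOf hg
    obtain ⟨l, rfl⟩ := exists_eq_refl_of_orderOf hh
    refine ⟨k, l, ?_, rfl, rfl⟩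
    -- Both generators lie in a subgroup whose rotations are multiples of `l - k`, so generating
    -- `rot 1` forces `l - k = ±1`.
    have hle : Subgroup.closure {refl k, refl l} ≤ reflectionSubgroup (l - k) k := by
      rw [Subgroup.closure_le]
      rintro _ (rfl | rfl)
      · exact .inr ⟨k, by simp, rfl⟩
      · exact .inr ⟨l, dvd_rfl, rfl⟩
    rw [htop] at hle
    obtain ⟨j, hj, h1⟩ | ⟨j, -, h1⟩ := hle (Subgroup.mem_top (rot 1))
    · rw [← rot_injective h1] at hj
      rcases Int.isUnit_iff.1 (isUnit_of_dvd_one hj) with h | h <;> omega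
    · exact (rot_ne_refl _ _ h1).elim
  · rintro ⟨k, l, hl, rfl, rfl⟩
    refine ⟨orderOf_refl k, orderOf_refl l, ?_⟩
    have hk : refl k ∈ Subgroup.closure {refl k, refl l} := Subgroup.subset_closure (by simp)
    have hl' : refl l ∈ Subgroup.closure {refl k, refl l} := Subgroup.subset_closure (by simp)
    refine eq_top_of_rot_one_mem ?_ hk
    rcases hl with rfl | rfl
    · have := Subgroup.mul_mem _ hk hl'
      rwa [refl_mul_refl, add_sub_cancel_left] at this
    · have := Subgroup.mul_mem _ hl' hk
      rwa [refl_mul_refl, sub_sub_cancel] at this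

/-- Conjugating `refl c` by `rot 1` and multiplying by `refl c` gives `rot 2`. With it, any odd
rotation would give back `rot 1`. -/
theorem mem_iff_of_refl_mem {H : Subgroup (DihedralGroup 0)} [hH : H.Normal] {c : ℤ}
    (hc : refl c ∈ H) (h1 : rot 1 ∉ H) :
    (∀ k, rot k ∈ H ↔ 2 ∣ k) ∧ ∀ k, refl k ∈ H ↔ 2 ∣ k - c := by
  have h2 : rot 2 ∈ H := by
    have h := H.mul_mem (hH.conj_mem _ hc (rot 1)) hc
    rwa [inv_rot, rot_mul_refl, refl_mul_rot, refl_mul_refl,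
      show c - (c - 1 + -1) = 2 by ring] at h
  have hr : ∀ k, rot k ∈ H ↔ 2 ∣ k := fun k => by
    constructor
    · intro hk
      by_contra hodd
      obtain ⟨j, rfl⟩ := Int.not_even_iff_odd.1 (fun h => hodd h.two_dvd)
      have := H.mul_mem (H.zpow_mem h2 (-j)) hk
      rw [rot_zpow, rot_mul_rot, show 2 * -j + (2 * j + 1) = 1 by ring] at this
      exact h1 this
    · rintro ⟨j, rfl⟩
      rw [← rot_zpow]
      exact H.zpow_mem h2 j
  refine ⟨hr, fun k => ?_⟩
  rw [← hr, ← refl_mul_refl]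
  exact (H.mul_mem_cancel_left hc).symm

theorem index_eq_two {H : Subgroup (DihedralGroup 0)} {c : ℤ}
    (hr : ∀ k, rot k ∈ H ↔ 2 ∣ k) (hs : ∀ k, refl k ∈ H ↔ 2 ∣ k - c) : H.index = 2 := by
  refine Subgroup.index_eq_two_iff.2 ⟨rot 1, fun g => ?_⟩
  obtain ⟨k, rfl⟩ | ⟨k, rfl⟩ := rot_or_refl g
  · rw [rot_mul_rot, hr, hr, xor_iff_iff_not]
    omega
  · rw [refl_mul_rot, hs, hs, xor_iff_iff_not]
    omega

theorem isInfiniteDihedral_of_mem_iff {H : Subgroup (DihedralGroup 0)} {c : ℤ}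
    (hr : ∀ k, rot k ∈ H ↔ 2 ∣ k) (hs : ∀ k, refl k ∈ H ↔ 2 ∣ k - c) : IsInfiniteDihedral H := by
  let F : DihedralGroup 0 → DihedralGroup 0
    | .r k => rot (2 * Int.cast k)
    | .sr k => refl (c + 2 * Int.cast k)
  have hF : ∀ k, F (rot k) = rot (2 * k) := fun k => rfl
  have hF' : ∀ k, F (refl k) = refl (c + 2 * k) := fun k => rfl
  have hmem : ∀ g, F g ∈ H := fun g => by
    obtain ⟨k, rfl⟩ | ⟨k, rfl⟩ := rot_or_refl g
    · rw [hF, hr]; omega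
    · rw [hF', hs]; omega
  have hmul : ∀ g h, F (g * h) = F g * F h := fun g h => by
    obtain ⟨k, rfl⟩ | ⟨k, rfl⟩ := rot_or_refl g <;> obtain ⟨l, rfl⟩ | ⟨l, rfl⟩ := rot_or_refl h <;>
      simp only [hF, hF', rot_mul_rot, rot_mul_refl, refl_mul_rot, refl_mul_refl] <;>
      congr 1 <;> ring
  let G : DihedralGroup 0 →* H := MonoidHom.mk' (fun g => ⟨F g, hmem g⟩) fun g h =>
    Subtype.ext (hmul g h)
  have hG : Function.Bijective G := by
    constructor
    · rw [injective_iff_map_eq_one]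
      intro g hg
      have h1 : F g = 1 := congrArg Subtype.val hg
      obtain ⟨k, rfl⟩ | ⟨k, rfl⟩ := rot_or_refl g
      · rw [hF, rot_eq_one_iff] at h1
        rw [rot_eq_one_iff]
        omega
      · exact (refl_ne_one _ h1).elim
    · rintro ⟨g, hg⟩
      obtain ⟨k, rfl⟩ | ⟨k, rfl⟩ := rot_or_refl g
      · obtain ⟨j, rfl⟩ := (hr k).1 hg
        exact ⟨rot j, rfl⟩
      · obtain ⟨j, hj⟩ := (hs k).1 hg
        exact ⟨refl j, Subtype.ext ((hF' j).trans (congrArg refl (by omega)))⟩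
  exact ⟨(MulEquiv.ofBijective G hG).symm⟩

theorem exists_rot_mem_iff {H : Subgroup (DihedralGroup 0)} [H.FiniteIndex] :
    ∃ m : ℕ, 0 < m ∧ ∀ k, rot k ∈ H ↔ (m : ℤ) ∣ k := by
  let R : AddSubgroup ℤ :=
    { carrier := {k | rot k ∈ H}
      zero_mem' := by simp [rot_zero]
      add_mem' := fun ha hb => by simpa [rot_mul_rot] using H.mul_mem ha hb
      neg_mem' := fun ha => by simpa [inv_rot] using H.inv_mem ha }
  obtain ⟨b, hb⟩ := Int.subgroup_cyclic R
  have hR : ∀ k, rot k ∈ H ↔ b ∣ k := fun k => by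
    rw [← Int.mem_zmultiples_iff, AddSubgroup.zmultiples_eq_closure, ← hb]
    rfl
  refine ⟨b.natAbs, ?_, fun k => by rw [hR, Int.natAbs_dvd]⟩
  rw [Int.natAbs_pos]
  rintro rfl
  obtain ⟨k, hk, hmem⟩ := Subgroup.exists_pow_mem_of_index_ne_zero
    (Subgroup.FiniteIndex.index_ne_zero (H := H)) (rot 1)
  rw [rot_pow, hR, zero_dvd_iff] at hmem
  omega

/-- Here `H` is the kernel of reduction modulo `m` onto the dihedral group of order `2 * m`. -/
theorem index_eq_two_mul {H : Subgroup (DihedralGroup 0)} (hs : ∀ c, refl c ∉ H) {m : ℕ}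
    (hr : ∀ k, rot k ∈ H ↔ (m : ℤ) ∣ k) : H.index = 2 * m := by
  let F : DihedralGroup 0 → DihedralGroup m
    | .r k => .r ((Int.cast k : ℤ) : ZMod m)
    | .sr k => .sr ((Int.cast k : ℤ) : ZMod m)
  have hF : ∀ k, F (rot k) = .r (k : ZMod m) := fun k => rfl
  have hF' : ∀ k, F (refl k) = .sr (k : ZMod m) := fun k => rfl
  let G : DihedralGroup 0 →* DihedralGroup m := MonoidHom.mk' F fun g h => by
    obtain ⟨k, rfl⟩ | ⟨k, rfl⟩ := rot_or_refl g <;> obtain ⟨l, rfl⟩ | ⟨l, rfl⟩ := rot_or_refl h <;>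
      simp [hF, hF', rot_mul_rot, rot_mul_refl, refl_mul_rot, refl_mul_refl]
  have hker : G.ker = H := by
    ext g
    rw [MonoidHom.mem_ker]
    obtain ⟨k, rfl⟩ | ⟨k, rfl⟩ := rot_or_refl g
    · rw [hr, ← ZMod.intCast_zmod_eq_zero_iff_dvd, DihedralGroup.one_def]
      exact ⟨fun h => DihedralGroup.r.inj h, fun h => congrArg DihedralGroup.r h⟩
    · exact ⟨fun h => (nomatch h), fun h => (hs k h).elim⟩
  have hsurj : Function.Surjective G := by
    rintro (k | k)
    · obtain ⟨j, rfl⟩ := ZMod.intCast_surjective k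
      exact ⟨rot j, rfl⟩
    · obtain ⟨j, rfl⟩ := ZMod.intCast_surjective k
      exact ⟨refl j, rfl⟩
  rw [← hker, Subgroup.index_ker, MonoidHom.range_eq_top.2 hsurj, Subgroup.card_top,
    DihedralGroup.nat_card]

theorem isInfiniteCyclic_of_mem_iff {H : Subgroup (DihedralGroup 0)} (hs : ∀ c, refl c ∉ H) {m : ℕ}
    (hm : 0 < m) (hr : ∀ k, rot k ∈ H ↔ (m : ℤ) ∣ k) : IsInfiniteCyclic H := by
  let G : Multiplicative ℤ →* H := MonoidHom.mk'
    (fun k => ⟨rot (m * k.toAdd), (hr _).2 (dvd_mul_right _ _)⟩) fun k l => Subtype.ext (by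
      simp [rot_mul_rot, mul_add])
  have hG : Function.Bijective G := by
    constructor
    · intro k l h
      have h1 := rot_injective (congrArg Subtype.val h)
      exact Multiplicative.toAdd.injective
        (mul_left_cancel₀ (Nat.cast_ne_zero.2 hm.ne') h1)
    · rintro ⟨g, hg⟩
      obtain ⟨k, rfl⟩ | ⟨k, rfl⟩ := rot_or_refl g
      · obtain ⟨j, rfl⟩ := (hr k).1 hg
        exact ⟨.ofAdd j, rfl⟩
      · exact (hs k hg).elim
  exact ⟨(MulEquiv.ofBijective G hG).symm⟩

theorem not_isInfiniteCyclic_of_refl_mem {H : Subgroup (DihedralGroup 0)} {c : ℤ}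
    (hc : refl c ∈ H) : ¬ IsInfiniteCyclic H := by
  rintro ⟨e⟩
  have h1 : e ⟨refl c, hc⟩ ^ 2 = 1 := by
    rw [← map_pow, map_eq_one_iff e e.injective]
    exact Subtype.ext (by simp [pow_two, refl_mul_refl, rot_zero])
  have h2 : e ⟨refl c, hc⟩ = 1 := by
    have : 2 • (e ⟨refl c, hc⟩).toAdd = 0 := h1
    exact (smul_eq_zero.1 this).resolve_left two_ne_zero
  rw [map_eq_one_iff e e.injective] at h2
  exact refl_ne_one c (congrArg Subtype.val h2)

theorem not_isInfiniteDihedral_of_refl_notMem {H : Subgroup (DihedralGroup 0)}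
    (hs : ∀ c, refl c ∉ H) : ¬ IsInfiniteDihedral H := by
  rintro ⟨e⟩
  have hcomm : ∀ x y : H, x * y = y * x := by
    rintro ⟨g, hg⟩ ⟨h, hh⟩
    obtain ⟨k, rfl⟩ := (rot_or_refl g).resolve_right fun ⟨k, hk⟩ => hs k (hk ▸ hg)
    obtain ⟨l, rfl⟩ := (rot_or_refl h).resolve_right fun ⟨k, hk⟩ => hs k (hk ▸ hh)
    exact Subtype.ext (by simp [rot_mul_rot, add_comm])
  have h := congrArg e (hcomm (e.symm (refl 0)) (e.symm (refl 1)))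
  simp only [map_mul, e.apply_symm_apply, refl_mul_refl] at h
  have := rot_injective h
  omega

end DihedralSubgroups

/-! ### Circles -/

section Circle

theorem addCircle_norm_mk_le (L x : ℝ) : ‖(x : AddCircle L)‖ ≤ |x| :=
  QuotientAddGroup.norm_mk_le_norm

theorem addCircle_coe_add_int_mul (L x : ℝ) (k : ℤ) : ((x + k * L : ℝ) : AddCircle L) = x := by
  rw [AddCircle.coe_add, ← zsmul_eq_mul, AddCircle.coe_zsmul, AddCircle.coe_period, smul_zero,
    add_zero]

theorem addCircle_coe_eq_coe_iff {L x y : ℝ} :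
    (x : AddCircle L) = y ↔ ∃ k : ℤ, y = x + k * L := by
  constructor
  · intro h
    obtain ⟨k, hk⟩ := AddSubgroup.mem_zmultiples_iff.1 ((QuotientAddGroup.eq).1 h)
    refine ⟨k, ?_⟩
    rw [← zsmul_eq_mul, hk]
    ring
  · rintro ⟨k, rfl⟩
    rw [addCircle_coe_add_int_mul]

theorem addCircle_eq_or_eq_neg_of_norm_eq {L : ℝ} {u v : AddCircle L} (h : ‖u‖ = ‖v‖) :
    u = v ∨ u = -v := by
  obtain ⟨x, rfl⟩ := QuotientAddGroup.mk_surjective u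
  obtain ⟨y, rfl⟩ := QuotientAddGroup.mk_surjective v
  change ‖(x : AddCircle L)‖ = ‖(y : AddCircle L)‖ at h
  rw [AddCircle.norm_eq, AddCircle.norm_eq] at h
  rcases abs_eq_abs.1 h with h | h
  · refine .inl (addCircle_coe_eq_coe_iff.2 ⟨round (L⁻¹ * y) - round (L⁻¹ * x), ?_⟩)
    push_cast
    linarith
  · refine .inr (addCircle_coe_eq_coe_iff.2 ⟨-round (L⁻¹ * y) - round (L⁻¹ * x), ?_⟩)
    push_cast
    linarith

/-- Adding half a period reflects the distance to the origin. -/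
theorem addCircle_norm_add_half {a : ℝ} (ha : 0 < a) (x : ℝ) :
    ‖((x + a : ℝ) : AddCircle (2 * a))‖ = a - ‖(x : AddCircle (2 * a))‖ := by
  have h2a : (2 * a) ≠ 0 := by positivity
  have habs : |2 * a| / 2 = a := by rw [abs_of_pos (by positivity)]; ring
  have key : ∀ t, |t| ≤ a → ‖((t + a : ℝ) : AddCircle (2 * a))‖ = a - |t| := fun t ht => by
    obtain ⟨h1, h2⟩ := abs_le.1 ht
    rcases le_total 0 t with h | h
    · have e : ((t + a : ℝ) : AddCircle (2 * a)) = ((t - a : ℝ) : AddCircle (2 * a)) :=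
        addCircle_coe_eq_coe_iff.2 ⟨-1, by push_cast; ring⟩
      have h3 : |t - a| = a - t := by rw [abs_of_nonpos (by linarith)]; ring
      rw [e, (AddCircle.norm_coe_eq_abs_iff _ h2a).2 (by rw [habs, h3]; linarith), h3,
        abs_of_nonneg h]
    · have h3 : |t + a| = a + t := by rw [abs_of_nonneg (by linarith)]; ring
      rw [(AddCircle.norm_coe_eq_abs_iff _ h2a).2 (by rw [habs, h3]; linarith), h3,
        abs_of_nonpos h, sub_neg_eq_add]
  have hx := AddCircle.norm_eq (2 * a) (x := x)
  have hle := AddCircle.norm_le_half_period (2 * a) (x := (x : AddCircle (2 * a))) h2a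
  rw [habs, hx] at hle
  rw [hx, ← key _ hle]
  congr 1
  exact addCircle_coe_eq_coe_iff.2 ⟨-round ((2 * a)⁻¹ * x), by push_cast; ring⟩

/-- Antipodal points are `ℓ / 2` apart, and no two points of the target are more than `L / 2` apart.
Hence the length of a circle is an isometry invariant. -/
theorem le_of_isometric_addCircle {ℓ L : ℝ} (hℓ : 0 < ℓ) (hL : 0 < L) (f : AddCircle ℓ → AddCircle L)
    (hf : ∀ x y, dist (f x) (f y) = dist x y) : ℓ ≤ L := by
  have h := hf ((ℓ / 2 : ℝ) : AddCircle ℓ) 0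
  rw [dist_zero_right, AddCircle.norm_half_period_eq, dist_eq_norm, abs_of_pos hℓ] at h
  have h2 := AddCircle.norm_le_half_period L (x := f ((ℓ / 2 : ℝ) : AddCircle ℓ) - f 0) hL.ne'
  rw [h, abs_of_pos hL] at h2
  linarith

theorem length_eq_of_isometric {Q : Type*} [Dist Q] {ℓ L : ℝ} (hℓ : 0 < ℓ) (hL : 0 < L)
    (φ : Q ≃ AddCircle ℓ) (hφ : ∀ p q, dist (φ p) (φ q) = dist p q)
    (ψ : Q ≃ AddCircle L) (hψ : ∀ p q, dist (ψ p) (ψ q) = dist p q) : ℓ = L :=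
  le_antisymm
    (le_of_isometric_addCircle hℓ hL (fun x => ψ (φ.symm x)) fun x y => by
      rw [hψ, ← hφ, φ.apply_symm_apply, φ.apply_symm_apply])
    (le_of_isometric_addCircle hL hℓ (fun x => φ (ψ.symm x)) fun x y => by
      rw [hφ, ← hψ, ψ.apply_symm_apply, ψ.apply_symm_apply])

/-- This separates reflections from rotations: a rotation with a fixed point is the identity. The
point `c / 2` is fixed, and not all points are, since doubling is not constant on the circle. -/
theorem IsCircleReflection.exists_fixed {Q : Type*} [Dist Q] {f : Q → Q}
    (h : IsCircleReflection f) : (∃ p, f p = p) ∧ ∃ p, f p ≠ p := by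
  obtain ⟨ℓ, hℓ, φ, -, c, hc⟩ := h
  obtain ⟨c, rfl⟩ := QuotientAddGroup.mk_surjective c
  change ∀ p, φ (f p) = (c : AddCircle ℓ) - φ p at hc
  constructor
  · refine ⟨φ.symm ((c / 2 : ℝ) : AddCircle ℓ), φ.injective ?_⟩
    rw [hc, φ.apply_symm_apply, ← AddCircle.coe_sub]
    congr 1
    ring
  · by_contra! h
    have h' : ∀ x : AddCircle ℓ, (c : AddCircle ℓ) = x + x := fun x => by
      have := hc (φ.symm x)
      rw [h, φ.apply_symm_apply] at this
      exact (eq_sub_iff_add_eq.1 this).symm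
    have h0 := h' ((ℓ / 4 : ℝ) : AddCircle ℓ)
    rw [h' 0, add_zero, ← AddCircle.coe_add, show ℓ / 4 + ℓ / 4 = ℓ / 2 by ring] at h0
    have h1 := AddCircle.norm_half_period_eq ℓ
    rw [← h0, norm_zero, abs_of_pos hℓ] at h1
    linarith

end Circle

/-! ### Orbit spaces of a line -/

section LineOrbits

variable {G X : Type*} [Group G] [MetricSpace X] (ρ : G →* Equiv.Perm X) (K : Subgroup G)

/-- A map which is constant exactly on the orbits and realizes the distance between orbits
identifies the orbit space with its target. -/
theorem orbitSpace_equiv_of_map {Y : Type*} [PseudoMetricSpace Y] (F : X → Y)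
    (hsurj : Function.Surjective F) (hF : ∀ x y, F x = F y ↔ ∃ h ∈ K, ρ h x = y)
    (hle : ∀ x y, dist (F x) (F y) ≤ dist x y)
    (hatt : ∀ x y, ∃ x' y', F x' = F x ∧ F y' = F y ∧ dist x' y' = dist (F x) (F y)) :
    ∃ Φ : OrbitSpace ρ K ≃ Y, (∀ p q, dist (Φ p) (Φ q) = dist p q) ∧
      ∀ x, Φ (Quotient.mk (orbitSetoid ρ K) x) = F x := by
  let Φ : OrbitSpace ρ K → Y := Quotient.lift F fun x y h => (hF x y).2 h
  have hΦ : Function.Bijective Φ := by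
    constructor
    · rintro ⟨x⟩ ⟨y⟩ h
      exact Quotient.sound ((hF x y).1 h)
    · intro y
      obtain ⟨x, rfl⟩ := hsurj y
      exact ⟨Quotient.mk _ x, rfl⟩
  refine ⟨Equiv.ofBijective Φ hΦ, ?_, fun x => rfl⟩
  rintro ⟨x⟩ ⟨y⟩
  change dist (F x) (F y) = sInf _
  refine (IsLeast.csInf_eq ⟨?_, ?_⟩).symm
  · obtain ⟨x', y', hx, hy, h⟩ := hatt x y
    exact ⟨x', y', Quotient.sound ((hF _ _).1 hx), Quotient.sound ((hF _ _).1 hy), h.symm⟩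
  · rintro _ ⟨x', y', hx, hy, rfl⟩
    rw [← (hF _ _).2 (Quotient.exact hx), ← (hF _ _).2 (Quotient.exact hy)]
    exact hle x' y'

variable (f : G →* DihedralGroup 0) (φ : X ≃ᵢ ℝ) {a : ℝ}

theorem orbitSpace_equiv_addCircle
    (hφ : ∀ g x, φ (ρ g x) = dihedralLine a (f g) (φ x))
    (hs : ∀ c, refl c ∉ K.map f) {m : ℕ} (hr : ∀ k, rot k ∈ K.map f ↔ (m : ℤ) ∣ k) :
    ∃ Φ : OrbitSpace ρ K ≃ AddCircle (a * m), (∀ p q, dist (Φ p) (Φ q) = dist p q) ∧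
      ∀ x, Φ (Quotient.mk (orbitSetoid ρ K) x) = (φ x : ℝ) := by
  have hF : ∀ x y : X, ((φ x : ℝ) : AddCircle (a * m)) = (φ y : ℝ) ↔ ∃ h ∈ K, ρ h x = y := by
    intro x y
    rw [addCircle_coe_eq_coe_iff]
    constructor
    · rintro ⟨k, hk⟩
      obtain ⟨h, hh, hfh⟩ := Subgroup.mem_map.1 ((hr (m * k)).2 (dvd_mul_right _ _))
      refine ⟨h, hh, φ.injective ?_⟩
      rw [hφ, hfh, dihedralLine_rot, hk]
      push_cast
      ring
    · rintro ⟨h, hh, rfl⟩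
      have hmem := Subgroup.mem_map_of_mem f hh
      obtain ⟨j, hj⟩ := (rot_or_refl (f h)).resolve_right fun ⟨c, hc⟩ => hs c (hc ▸ hmem)
      rw [hj, hr] at hmem
      obtain ⟨k, rfl⟩ := hmem
      refine ⟨k, ?_⟩
      rw [hφ, hj, dihedralLine_rot]
      push_cast
      ring
  refine orbitSpace_equiv_of_map ρ K (fun x => ((φ x : ℝ) : AddCircle (a * m))) ?_ hF ?_ ?_
  · intro y
    obtain ⟨t, rfl⟩ := QuotientAddGroup.mk_surjective y
    exact ⟨φ.symm t, congrArg _ (φ.apply_symm_apply t)⟩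
  · intro x y
    rw [dist_eq_norm, ← AddCircle.coe_sub, ← φ.dist_eq x y, Real.dist_eq]
    exact addCircle_norm_mk_le _ _
  · intro x y
    -- The nearest representative of the orbit of `y`, found by rounding, attains the distance.
    refine ⟨x, φ.symm (φ y + round ((a * m)⁻¹ * (φ x - φ y)) * (a * m)), rfl, ?_, ?_⟩
    · rw [φ.apply_symm_apply, addCircle_coe_add_int_mul]
    · rw [dist_eq_norm (a := ((φ x : ℝ) : AddCircle (a * m))), ← AddCircle.coe_sub,
        AddCircle.norm_eq, ← φ.dist_eq, φ.apply_symm_apply, Real.dist_eq]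
      congr 1
      ring

/-- The mirrors of `K` are the points `-a * c / 2 + a * j`. After recentring by `a * c / 2`, the
quotient by the rotations is a circle of length `2 * a`, and the norm folds it along the mirrors `0`
and `a`. -/
theorem orbitSpace_equiv_Icc (ha : 0 < a)
    (hφ : ∀ g x, φ (ρ g x) = dihedralLine a (f g) (φ x)) {c : ℤ}
    (hr : ∀ k, rot k ∈ K.map f ↔ 2 ∣ k) (hs : ∀ k, refl k ∈ K.map f ↔ 2 ∣ k - c) :
    ∃ Φ : OrbitSpace ρ K ≃ Set.Icc (0 : ℝ) a, (∀ p q, dist (Φ p) (Φ q) = dist p q) ∧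
      ∀ x, (Φ (Quotient.mk (orbitSetoid ρ K) x) : ℝ) =
        ‖((φ x + a * c / 2 : ℝ) : AddCircle (2 * a))‖ := by
  set F₀ : X → ℝ := fun x => ‖((φ x + a * c / 2 : ℝ) : AddCircle (2 * a))‖ with hF₀
  have hF₀le : ∀ x, F₀ x ≤ a := fun x => by
    have h := AddCircle.norm_le_half_period (2 * a)
      (x := ((φ x + a * c / 2 : ℝ) : AddCircle (2 * a))) (by positivity)
    rw [abs_of_pos (by positivity)] at h
    linarith
  let F : X → Set.Icc (0 : ℝ) a := fun x => ⟨F₀ x, norm_nonneg _, hF₀le x⟩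
  let σ : ℝ → X := fun t => φ.symm (t - a * c / 2)
  have hσ : ∀ t, φ (σ t) = t - a * c / 2 := fun t => φ.apply_symm_apply _
  have hinv : ∀ h ∈ K, ∀ x, F₀ (ρ h x) = F₀ x := fun h hh x => by
    have hmem := Subgroup.mem_map_of_mem f hh
    obtain ⟨k, hk⟩ | ⟨k, hk⟩ := rot_or_refl (f h)
    · rw [hk, hr] at hmem
      obtain ⟨j, rfl⟩ := hmem
      simp only [hF₀]
      rw [hφ, hk, dihedralLine_rot]
      congr 1
      refine (addCircle_coe_eq_coe_iff.2 ⟨j, ?_⟩).symm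
      push_cast
      ring
    · rw [hk, hs] at hmem
      obtain ⟨j, hj⟩ := hmem
      obtain rfl : k = c + 2 * j := by omega
      simp only [hF₀]
      rw [hφ, hk, dihedralLine_refl, ← norm_neg (((φ x + _ : ℝ) : AddCircle (2 * a))),
        ← AddCircle.coe_neg]
      congr 1
      refine (addCircle_coe_eq_coe_iff.2 ⟨-j, ?_⟩).symm
      push_cast
      ring
  -- Every orbit meets the fundamental segment parametrised by `σ` on `[0, a]`: a rotation brings
  -- the coordinate to its residue nearest to 0, and a reflection is used instead when that residue
  -- is negative.
  have hcan : ∀ x, ∃ h ∈ K, ρ h x = σ (F₀ x) := fun x => by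
    set r := round ((2 * a)⁻¹ * (φ x + a * c / 2))
    have hn : F₀ x = |φ x + a * c / 2 - r * (2 * a)| := AddCircle.norm_eq _
    rcases abs_choice (φ x + a * c / 2 - r * (2 * a)) with h | h
    · obtain ⟨κ, hκ, hfκ⟩ := Subgroup.mem_map.1 ((hr (2 * -r)).2 (dvd_mul_right _ _))
      refine ⟨κ, hκ, φ.injective ?_⟩
      rw [hφ, hfκ, dihedralLine_rot, hσ, hn, h]
      push_cast
      ring
    · obtain ⟨κ, hκ, hfκ⟩ := Subgroup.mem_map.1 ((hs (c + 2 * -r)).2 (by simp))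
      refine ⟨κ, hκ, φ.injective ?_⟩
      rw [hφ, hfκ, dihedralLine_refl, hσ, hn, h]
      push_cast
      ring
  have hF : ∀ x y, F x = F y ↔ ∃ h ∈ K, ρ h x = y := fun x y => by
    constructor
    · intro h
      have h0 : F₀ x = F₀ y := congrArg (fun z : Set.Icc (0 : ℝ) a => (z : ℝ)) h
      obtain ⟨g, hg, hgx⟩ := hcan x
      obtain ⟨k, hk, hky⟩ := hcan y
      refine ⟨k⁻¹ * g, K.mul_mem (K.inv_mem hk) hg, ?_⟩
      rw [map_mul, Equiv.Perm.mul_apply, hgx, h0, ← hky, map_inv]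
      exact (ρ k).symm_apply_apply y
    · rintro ⟨h, hh, rfl⟩
      exact Subtype.ext (hinv h hh x).symm
  have hFσ : ∀ x, F (σ (F₀ x)) = F x := fun x => ((hF _ _).2 (hcan x)).symm
  suffices ∃ Φ : OrbitSpace ρ K ≃ Set.Icc (0 : ℝ) a, (∀ p q, dist (Φ p) (Φ q) = dist p q) ∧
      ∀ x, Φ (Quotient.mk (orbitSetoid ρ K) x) = F x by
    obtain ⟨Φ, h1, h2⟩ := this
    exact ⟨Φ, h1, fun x => congrArg (fun z : Set.Icc (0 : ℝ) a => (z : ℝ)) (h2 x)⟩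
  refine orbitSpace_equiv_of_map ρ K F ?_ hF ?_ ?_
  · rintro ⟨t, ht0, hta⟩
    refine ⟨σ t, Subtype.ext ?_⟩
    change ‖((φ (σ t) + a * c / 2 : ℝ) : AddCircle (2 * a))‖ = t
    rw [hσ, sub_add_cancel, (AddCircle.norm_coe_eq_abs_iff _ (by positivity)).2, abs_of_nonneg ht0]
    rw [abs_of_nonneg ht0, abs_of_pos (by positivity)]
    linarith
  · intro x y
    rw [← φ.dist_eq x y, Subtype.dist_eq, Real.dist_eq, Real.dist_eq]
    refine (abs_norm_sub_norm_le _ _).trans ?_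
    rw [← AddCircle.coe_sub, add_sub_add_right_eq_sub]
    exact addCircle_norm_mk_le _ _
  · intro x y
    refine ⟨σ (F₀ x), σ (F₀ y), hFσ x, hFσ y, ?_⟩
    rw [← φ.dist_eq, hσ, hσ, Subtype.dist_eq, Real.dist_eq, Real.dist_eq, sub_sub_sub_cancel_right]

variable [hK : K.Normal]

/-- Outside `K`, up to sign, an element acts on the circle of length `2 * a` as the half-turn, which
exchanges the two mirrors and turns the norm `t` into `a - t`. -/
theorem isIntervalReflection_map (ha : 0 < a)
    (hφ : ∀ g x, φ (ρ g x) = dihedralLine a (f g) (φ x)) {c : ℤ}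
    (hr : ∀ k, rot k ∈ K.map f ↔ 2 ∣ k) (hs : ∀ k, refl k ∈ K.map f ↔ 2 ∣ k - c)
    {g : G} (hg : f g ∉ K.map f) : IsIntervalReflection (OrbitSpace.map ρ K g) := by
  obtain ⟨Φ, hΦ, hΦmk⟩ := orbitSpace_equiv_Icc ρ K f φ ha hφ hr hs
  refine ⟨a, ha, Φ, hΦ, ?_⟩
  rintro ⟨x⟩
  change (Φ (Quotient.mk _ (ρ g x)) : ℝ) = a - (Φ (Quotient.mk _ x) : ℝ)
  rw [hΦmk, hΦmk, ← addCircle_norm_add_half ha, hφ]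
  obtain ⟨k, hk⟩ | ⟨k, hk⟩ := rot_or_refl (f g)
  · rw [hk, hr] at hg
    obtain ⟨j, rfl⟩ : ∃ j, k = 1 + 2 * j := ⟨k / 2, by omega⟩
    rw [hk, dihedralLine_rot]
    congr 1
    refine (addCircle_coe_eq_coe_iff.2 ⟨j, ?_⟩).symm
    push_cast
    ring
  · rw [hk, hs] at hg
    obtain ⟨j, rfl⟩ : ∃ j, k = c + 1 + 2 * j := ⟨(k - c) / 2, by omega⟩
    rw [hk, dihedralLine_refl, ← norm_neg (((φ x + a * c / 2 + a : ℝ) : AddCircle (2 * a))),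
      ← AddCircle.coe_neg]
    congr 1
    refine (addCircle_coe_eq_coe_iff.2 ⟨-j, ?_⟩).symm
    push_cast
    ring

variable {L : ℝ}

theorem orbitSpace_map_rot (hφ : ∀ g x, φ (ρ g x) = dihedralLine a (f g) (φ x))
    {Φ : OrbitSpace ρ K ≃ AddCircle L}
    (hΦ : ∀ x, Φ (Quotient.mk (orbitSetoid ρ K) x) = (φ x : ℝ)) {g : G} {k : ℤ}
    (hg : f g = rot k) (p : OrbitSpace ρ K) :
    Φ (OrbitSpace.map ρ K g p) = Φ p + ((a * k : ℝ) : AddCircle L) := by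
  obtain ⟨x⟩ := p
  change Φ (Quotient.mk _ (ρ g x)) = Φ (Quotient.mk _ x) + _
  rw [hΦ, hΦ, hφ, hg, dihedralLine_rot, AddCircle.coe_add]

theorem orbitSpace_map_refl (hφ : ∀ g x, φ (ρ g x) = dihedralLine a (f g) (φ x))
    {Φ : OrbitSpace ρ K ≃ AddCircle L}
    (hΦ : ∀ x, Φ (Quotient.mk (orbitSetoid ρ K) x) = (φ x : ℝ)) {g : G} {k : ℤ}
    (hg : f g = refl k) (p : OrbitSpace ρ K) :
    Φ (OrbitSpace.map ρ K g p) = ((-(a * k) : ℝ) : AddCircle L) - Φ p := by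
  obtain ⟨x⟩ := p
  change Φ (Quotient.mk _ (ρ g x)) = _ - Φ (Quotient.mk _ x)
  rw [hΦ, hΦ, hφ, hg, dihedralLine_refl, ← AddCircle.coe_sub]
  congr 1
  ring

end LineOrbits

/-! ### Coxeter pairs modulo a normal subgroup and their action on the orbit space -/

section Classification

variable {G X : Type*} [Group G] [MetricSpace X] (ρ : G →* Equiv.Perm X) (K : Subgroup G)
  [hK : K.Normal] (f : G →* DihedralGroup 0) (φ : X ≃ᵢ ℝ) {a : ℝ}

/-- Two elements `g₁`, `g₂` of the infinite dihedral group are congruent modulo `H` to a pair of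
Coxeter generators. -/
def IsCoxeterPairMod (H : Subgroup (DihedralGroup 0)) (g₁ g₂ : DihedralGroup 0) : Prop :=
  ∃ k l : ℤ, (l = k + 1 ∨ l = k - 1) ∧ g₁⁻¹ * refl k ∈ H ∧ g₂⁻¹ * refl l ∈ H

theorem exists_refl_of_isCircleReflection {L : ℝ}
    (hφ : ∀ g x, φ (ρ g x) = dihedralLine a (f g) (φ x)) {Φ : OrbitSpace ρ K ≃ AddCircle L}
    (hΦ : ∀ x, Φ (Quotient.mk (orbitSetoid ρ K) x) = (φ x : ℝ)) {g : G}
    (hg : IsCircleReflection (OrbitSpace.map ρ K g)) : ∃ k, f g = refl k := by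
  refine (rot_or_refl (f g)).resolve_left ?_
  rintro ⟨k, hk⟩
  obtain ⟨⟨p, hp⟩, q, hq⟩ := hg.exists_fixed
  have hrot := orbitSpace_map_rot ρ K f φ hφ hΦ hk
  have h0 : ((a * k : ℝ) : AddCircle L) = 0 := by
    have := hrot p
    rwa [hp, left_eq_add] at this
  exact hq (Φ.injective (by rw [hrot, h0, add_zero]))

theorem isCircleReflection_map_refl {L : ℝ} (hL : 0 < L)
    (hφ : ∀ g x, φ (ρ g x) = dihedralLine a (f g) (φ x)) {Φ : OrbitSpace ρ K ≃ AddCircle L}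
    (hΦd : ∀ p q, dist (Φ p) (Φ q) = dist p q)
    (hΦ : ∀ x, Φ (Quotient.mk (orbitSetoid ρ K) x) = (φ x : ℝ)) {g : G} {k : ℤ}
    (hg : f g = refl k) : IsCircleReflection (OrbitSpace.map ρ K g) :=
  ⟨L, hL, Φ, hΦd, _, orbitSpace_map_refl ρ K f φ hφ hΦ hg⟩

theorem addCircle_mul_int_eq_iff (ha : 0 < a) {m : ℕ} {i j : ℤ} :
    ((a * i : ℝ) : AddCircle (a * m)) = ((a * j : ℝ) : AddCircle (a * m)) ↔ (m : ℤ) ∣ j - i := by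
  rw [addCircle_coe_eq_coe_iff]
  have h : ∀ k : ℤ, a * j = a * i + k * (a * m) ↔ j - i = m * k := fun k => by
    constructor
    · intro h
      have h1 : a * ((j : ℝ) - i) = a * (m * k) := by linarith
      exact_mod_cast mul_left_cancel₀ ha.ne' h1
    · intro h
      have h1 : (j : ℝ) - i = m * k := by exact_mod_cast h
      rw [eq_add_of_sub_eq' h1]
      ring
  exact exists_congr h

/-- A rotation is defined through some unspecified identification with a circle, so only its
displacement is intrinsic. This fixes the angle up to sign, which is why both signs must be taken
together. -/
theorem isCircleRotation_map_rot_iff (ha : 0 < a) {m : ℕ} (hm : 0 < m)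
    (hφ : ∀ g x, φ (ρ g x) = dihedralLine a (f g) (φ x))
    {Φ : OrbitSpace ρ K ≃ AddCircle (a * m)} (hΦd : ∀ p q, dist (Φ p) (Φ q) = dist p q)
    (hΦ : ∀ x, Φ (Quotient.mk (orbitSetoid ρ K) x) = (φ x : ℝ)) {g : G} {k : ℤ}
    (hg : f g = rot k) :
    (IsCircleRotation (OrbitSpace.map ρ K g) (2 * Real.pi / m) ∨
      IsCircleRotation (OrbitSpace.map ρ K g) (-(2 * Real.pi / m))) ↔
        (m : ℤ) ∣ k - 1 ∨ (m : ℤ) ∣ k + 1 := by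
  have hm' : (m : ℝ) ≠ 0 := by positivity
  have hrot := orbitSpace_map_rot ρ K f φ hφ hΦ hg
  have hang : ∀ L : ℝ, 2 * Real.pi / m / (2 * Real.pi) * L = L / m := fun L => by
    field_simp
  have hang' : ∀ L : ℝ, -(2 * Real.pi / m) / (2 * Real.pi) * L = -(L / m) := fun L => by
    field_simp
  have ha1 : ((a * (1 : ℤ) : ℝ) : AddCircle (a * m)) = ((a * m / m : ℝ) : AddCircle (a * m)) := by
    rw [mul_div_cancel_right₀ _ hm', Int.cast_one, mul_one]
  have ha2 : ((a * (-1 : ℤ) : ℝ) : AddCircle (a * m)) =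
      ((-(a * m / m) : ℝ) : AddCircle (a * m)) := by
    rw [mul_div_cancel_right₀ _ hm']
    congr 1
    push_cast
    ring
  constructor
  · intro h
    have hdisp : ∃ (L : ℝ) (ψ : OrbitSpace ρ K ≃ AddCircle L), 0 < L ∧
        (∀ p q, dist (ψ p) (ψ q) = dist p q) ∧
        ∀ p, dist (OrbitSpace.map ρ K g p) p = ‖((L / m : ℝ) : AddCircle L)‖ := by
      obtain ⟨L, hL, ψ, hψ, h⟩ | ⟨L, hL, ψ, hψ, h⟩ := h <;>
        refine ⟨L, ψ, hL, hψ, fun p => ?_⟩ <;>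
        rw [← hψ, h, dist_eq_norm, add_sub_cancel_left]
      · rw [hang]
      · rw [hang', AddCircle.coe_neg, norm_neg]
    obtain ⟨L, ψ, hL, hψ, h⟩ := hdisp
    obtain rfl := length_eq_of_isometric hL (by positivity) ψ hψ Φ hΦd
    have h1 := h (Φ.symm 0)
    rw [← hΦd, hrot, dist_eq_norm, add_sub_cancel_left] at h1
    rcases addCircle_eq_or_eq_neg_of_norm_eq h1 with h1 | h1
    · rw [← ha1, eq_comm, addCircle_mul_int_eq_iff ha] at h1
      exact .inl h1
    · rw [← AddCircle.coe_neg, ← ha2, eq_comm, addCircle_mul_int_eq_iff ha, sub_neg_eq_add] at h1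
      exact .inr h1
  · have hL : 0 < a * m := by positivity
    rintro (h | h)
    · refine .inl ⟨a * m, hL, Φ, hΦd, fun p => ?_⟩
      rw [hrot, hang, ← ha1, (addCircle_mul_int_eq_iff ha).2 h]
    · refine .inr ⟨a * m, hL, Φ, hΦd, fun p => ?_⟩
      rw [hrot, hang', ← ha2, (addCircle_mul_int_eq_iff ha (i := -1)).2 (by rwa [sub_neg_eq_add])]

theorem isCoxeterPairMod_iff_of_refl_notMem {H : Subgroup (DihedralGroup 0)}
    (hs : ∀ c, refl c ∉ H) {m : ℕ} (hr : ∀ k, rot k ∈ H ↔ (m : ℤ) ∣ k) {g₁ g₂ : DihedralGroup 0} :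
    IsCoxeterPairMod H g₁ g₂ ↔ ∃ i j, g₁ = refl i ∧ g₂ = refl j ∧
      ((m : ℤ) ∣ (j - i) - 1 ∨ (m : ℤ) ∣ (j - i) + 1) := by
  have key : ∀ g k, g⁻¹ * refl k ∈ H ↔ ∃ i, g = refl i ∧ (m : ℤ) ∣ k - i := fun g k => by
    obtain ⟨i, rfl⟩ | ⟨i, rfl⟩ := rot_or_refl g
    · rw [inv_rot, rot_mul_refl]
      exact ⟨fun h => (hs _ h).elim, fun ⟨j, hj, _⟩ => (rot_ne_refl _ _ hj).elim⟩
    · rw [inv_refl, refl_mul_refl, hr]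
      exact ⟨fun h => ⟨i, rfl, h⟩, fun ⟨j, hj, h⟩ => refl_injective hj ▸ h⟩
  constructor
  · rintro ⟨k, l, hkl, h1, h2⟩
    obtain ⟨i, rfl, hi⟩ := (key _ _).1 h1
    obtain ⟨j, rfl, hj⟩ := (key _ _).1 h2
    refine ⟨i, j, rfl, rfl, ?_⟩
    have h := dvd_sub hi hj
    rcases hkl with rfl | rfl
    · exact .inl (by rwa [show k - i - (k + 1 - j) = j - i - 1 by ring] at h)
    · exact .inr (by rwa [show k - i - (k - 1 - j) = j - i + 1 by ring] at h)
  · rintro ⟨i, j, rfl, rfl, h⟩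
    have hi : (refl i)⁻¹ * refl i ∈ H := by rw [inv_mul_cancel]; exact H.one_mem
    rcases h with h | h
    · refine ⟨i, i + 1, .inl rfl, hi, (key _ _).2 ⟨j, rfl, ?_⟩⟩
      rwa [← dvd_neg, show -(i + 1 - j) = j - i - 1 by ring]
    · refine ⟨i, i - 1, .inr rfl, hi, (key _ _).2 ⟨j, rfl, ?_⟩⟩
      rwa [← dvd_neg, show -(i - 1 - j) = j - i + 1 by ring]

/-- If the translation and reflections in `H` have step two, then a pair is congruent to a pair of
Coxeter generators if and only if exactly one of its members is in `H`. -/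
theorem isCoxeterPairMod_iff_of_refl_mem {H : Subgroup (DihedralGroup 0)} {c : ℤ}
    (hr : ∀ k, rot k ∈ H ↔ 2 ∣ k) (hs : ∀ k, refl k ∈ H ↔ 2 ∣ k - c) {g₁ g₂ : DihedralGroup 0} :
    IsCoxeterPairMod H g₁ g₂ ↔ (g₁ ∈ H ∧ g₂ ∉ H) ∨ (g₂ ∈ H ∧ g₁ ∉ H) := by
  -- Modulo a subgroup of index two, congruence means being both inside or both outside. Adjacent
  -- reflections have opposite parity, so exactly one of them is in `H`.
  have key : ∀ g k, g⁻¹ * refl k ∈ H ↔ (g ∈ H ↔ 2 ∣ k - c) := fun g k => by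
    rw [Subgroup.mul_mem_iff_of_index_two (index_eq_two hr hs), inv_mem_iff, hs]
  constructor
  · rintro ⟨k, l, hkl, h1, h2⟩
    rw [key] at h1 h2
    rw [h1, h2]
    omega
  · rintro (⟨h1, h2⟩ | ⟨h1, h2⟩)
    · refine ⟨c, c + 1, .inl rfl, (key _ _).2 ?_, (key _ _).2 ?_⟩
      · simp [h1]
      · simp only [h2, false_iff]; omega
    · refine ⟨c + 1, c, .inr (by ring), (key _ _).2 ?_, (key _ _).2 ?_⟩
      · simp only [h2, false_iff]; omega
      · simp [h1]

theorem map_normal_of_surjective {f : G →* DihedralGroup 0} (hf : Function.Surjective f) :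
    (K.map f).Normal := hK.map f hf

/-- The classification of the pairs of Coxeter generators modulo a normal subgroup in terms of the
induced action on the orbit space of the line. -/
theorem isCoxeterPairMod_map_iff (ha : 0 < a) (hf : Function.Surjective f)
    (hφ : ∀ g x, φ (ρ g x) = dihedralLine a (f g) (φ x)) (hfin : (K.map f).FiniteIndex)
    (hKf : ∀ κ ∈ K, f κ = 1 → κ = 1) {γ₁ γ₂ : G}
    (hgen : f γ₁ ∈ K.map f → f γ₂ ∈ K.map f → K.map f = ⊤) :
    IsCoxeterPairMod (K.map f) (f γ₁) (f γ₂) ↔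
      (K.map f).index = 1 ∨
      ((K.map f).index = 2 ∧ IsInfiniteDihedral K ∧
        ((f γ₁ ∈ K.map f ∧ IsIntervalReflection (OrbitSpace.map ρ K γ₂)) ∨
          (f γ₂ ∈ K.map f ∧ IsIntervalReflection (OrbitSpace.map ρ K γ₁)))) ∨
      ∃ m : ℕ, 0 < m ∧ (K.map f).index = 2 * m ∧ IsInfiniteCyclic K ∧
        IsCircleReflection (OrbitSpace.map ρ K γ₁) ∧
        IsCircleReflection (OrbitSpace.map ρ K γ₂) ∧
        (IsCircleRotation (OrbitSpace.map ρ K (γ₁ * γ₂)) (2 * Real.pi / m) ∨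
          IsCircleRotation (OrbitSpace.map ρ K (γ₁ * γ₂)) (-(2 * Real.pi / m))) := by
  have := map_normal_of_surjective K hf
  let E₀ : K ≃* K.map f := MulEquiv.ofBijective (f.subgroupMap K) ⟨by
    rw [injective_iff_map_eq_one]
    exact fun κ hκ => Subtype.ext (hKf κ κ.2 (congrArg Subtype.val hκ)),
    f.subgroupMap_surjective K⟩
  have hdih : IsInfiniteDihedral K ↔ IsInfiniteDihedral (K.map f) :=
    ⟨fun ⟨e⟩ => ⟨E₀.symm.trans e⟩, fun ⟨e⟩ => ⟨E₀.trans e⟩⟩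
  have hcyc : IsInfiniteCyclic K ↔ IsInfiniteCyclic (K.map f) :=
    ⟨fun ⟨e⟩ => ⟨E₀.symm.trans e⟩, fun ⟨e⟩ => ⟨E₀.trans e⟩⟩
  rw [hdih, hcyc]
  by_cases hs : ∃ c, refl c ∈ K.map f
  · obtain ⟨c, hc⟩ := hs
    by_cases h1 : rot 1 ∈ K.map f
    · have htop := eq_top_of_rot_one_mem h1 hc
      refine iff_of_true ⟨0, 1, .inl rfl, ?_, ?_⟩ (.inl (by rw [htop, Subgroup.index_top]))
      all_goals rw [htop]; exact Subgroup.mem_top _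
    · obtain ⟨hr, hs⟩ := mem_iff_of_refl_mem hc h1
      have hint := fun g hg => isIntervalReflection_map ρ K f φ ha hφ hr hs (g := g) hg
      have hidx := index_eq_two hr hs
      rw [isCoxeterPairMod_iff_of_refl_mem hr hs, hidx]
      constructor
      · rintro (⟨h1, h2⟩ | ⟨h1, h2⟩)
        · exact .inr (.inl ⟨rfl, isInfiniteDihedral_of_mem_iff hr hs, .inl ⟨h1, hint _ h2⟩⟩)
        · exact .inr (.inl ⟨rfl, isInfiniteDihedral_of_mem_iff hr hs, .inr ⟨h1, hint _ h2⟩⟩)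
      -- In the converse, generation is what puts the second element outside the image of `K`: two
      -- elements inside it would generate only the trivial quotient.
      · have htop : K.map f ≠ ⊤ := fun h => by
          rw [h, Subgroup.index_top] at hidx
          omega
        rintro (h | ⟨-, -, ⟨h, -⟩ | ⟨h, -⟩⟩ | ⟨m, -, -, h, -⟩)
        · omega
        · exact .inl ⟨h, fun h' => htop (hgen h h')⟩
        · exact .inr ⟨h, fun h' => htop (hgen h' h)⟩
        · exact (not_isInfiniteCyclic_of_refl_mem hc h).elim
  · push Not at hs
    obtain ⟨m, hm, hr⟩ := exists_rot_mem_iff (H := K.map f)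
    obtain ⟨Φ, hΦd, hΦ⟩ := orbitSpace_equiv_addCircle ρ K f φ hφ hs hr
    have hidx := index_eq_two_mul hs hr
    have hmul : ∀ {i j}, f γ₁ = refl i → f γ₂ = refl j → f (γ₁ * γ₂) = rot (j - i) :=
      fun h1 h2 => by rw [map_mul, h1, h2, refl_mul_refl]
    have hrefl := fun {g k} => isCircleReflection_map_refl ρ K f φ (g := g) (k := k)
      (by positivity) hφ hΦd hΦ
    have hrot := fun {k} => isCircleRotation_map_rot_iff ρ K f φ (g := γ₁ * γ₂) (k := k) ha hm hφ
      hΦd hΦ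
    rw [isCoxeterPairMod_iff_of_refl_notMem hs hr, hidx]
    constructor
    · rintro ⟨i, j, hi, hj, h⟩
      exact .inr (.inr ⟨m, hm, rfl, isInfiniteCyclic_of_mem_iff hs hm hr, hrefl hi, hrefl hj,
        (hrot (hmul hi hj)).2 h⟩)
    · rintro (h | ⟨-, h, -⟩ | ⟨m', -, hm', -, h1, h2, h3⟩)
      · omega
      · exact (not_isInfiniteDihedral_of_refl_notMem hs h).elim
      -- The index identifies the `m'` of the statement with the step of the rotations in the image
      -- of `K`.
      · obtain rfl : m' = m := by omega
        obtain ⟨i, hi⟩ := exists_refl_of_isCircleReflection ρ K f φ hφ hΦ h1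
        obtain ⟨j, hj⟩ := exists_refl_of_isCircleReflection ρ K f φ hφ hΦ h2
        exact ⟨i, j, hi, hj, (hrot (hmul hi hj)).1 h3⟩

end Classification

/-! ### Passage from `Γ/N` and `Γ/NK` to the infinite dihedral group -/

section CoxeterGenerators

variable {n : ℕ} {Γ : Subgroup (Isom n)} (N : Subgroup Γ) [N.Normal]

theorem isCoxeterGenerators_map_iff {G H : Type*} [Group G] [Group H] (e : G ≃* H) (x y : G) :
    IsCoxeterGenerators (e x) (e y) ↔ IsCoxeterGenerators x y := by
  have h : Subgroup.closure {e x, e y} = (Subgroup.closure {x, y}).map e.toMonoidHom := by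
    rw [MonoidHom.map_closure, Set.image_pair]
    rfl
  unfold IsCoxeterGenerators
  rw [MulEquiv.orderOf_eq, MulEquiv.orderOf_eq, h,
    ← Subgroup.map_top_of_surjective e.toMonoidHom e.surjective,
    (Subgroup.map_injective e.injective).eq_iff]

variable (e : Γ ⧸ N ≃* DihedralGroup 0)

theorem comap_map_actionKernel :
    ((actionKernel N).map (e.toMonoidHom.comp (QuotientGroup.mk' N))).comap
      (e.toMonoidHom.comp (QuotientGroup.mk' N)) = N ⊔ actionKernel N := by
  rw [Subgroup.comap_map_eq, sup_comm]
  congr 1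
  ext γ
  rw [MonoidHom.mem_ker]
  exact (map_eq_one_iff e e.injective).trans (QuotientGroup.eq_one_iff γ)

theorem toStructureGroup_eq_iff (γ δ : Γ) :
    toStructureGroup N γ = toStructureGroup N δ ↔
      (e γ)⁻¹ * e δ ∈ (actionKernel N).map (e.toMonoidHom.comp (QuotientGroup.mk' N)) := by
  refine QuotientGroup.eq.trans ?_
  rw [← comap_map_actionKernel N e, Subgroup.mem_comap, map_mul, map_inv]
  rfl

/-- Equality of unordered pairs may swap `δ₁` and `δ₂`; this is harmless because adjacency of
reflections is symmetric. -/
theorem exists_coxeterGenerators_iff (γ₁ γ₂ : Γ) :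
    (∃ δ₁ δ₂ : Γ, ({toStructureGroup N γ₁, toStructureGroup N γ₂} : Set (StructureGroup N)) =
        {toStructureGroup N δ₁, toStructureGroup N δ₂} ∧
        IsCoxeterGenerators (δ₁ : Γ ⧸ N) (δ₂ : Γ ⧸ N)) ↔
      IsCoxeterPairMod ((actionKernel N).map (e.toMonoidHom.comp (QuotientGroup.mk' N)))
        (e γ₁) (e γ₂) := by
  constructor
  · rintro ⟨δ₁, δ₂, hset, hcox⟩
    rw [← isCoxeterGenerators_map_iff e, isCoxeterGenerators_iff] at hcox
    obtain ⟨k, l, hkl, hk, hl⟩ := hcox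
    rcases Set.pair_eq_pair_iff.1 hset with ⟨h1, h2⟩ | ⟨h1, h2⟩
    · rw [toStructureGroup_eq_iff N e] at h1 h2
      exact ⟨k, l, hkl, hk ▸ h1, hl ▸ h2⟩
    · rw [toStructureGroup_eq_iff N e] at h1 h2
      exact ⟨l, k, by omega, hl ▸ h1, hk ▸ h2⟩
  · rintro ⟨k, l, hkl, h1, h2⟩
    obtain ⟨δ₁, hδ₁⟩ := QuotientGroup.mk_surjective (e.symm (refl k))
    obtain ⟨δ₂, hδ₂⟩ := QuotientGroup.mk_surjective (e.symm (refl l))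
    have hk : e δ₁ = refl k := by rw [hδ₁, e.apply_symm_apply]
    have hl : e δ₂ = refl l := by rw [hδ₂, e.apply_symm_apply]
    refine ⟨δ₁, δ₂, ?_, ?_⟩
    · rw [(toStructureGroup_eq_iff N e γ₁ δ₁).2 (by rwa [hk]),
        (toStructureGroup_eq_iff N e γ₂ δ₂).2 (by rwa [hl])]
    · rw [← isCoxeterGenerators_map_iff e, isCoxeterGenerators_iff]
      exact ⟨k, l, hkl, hk, hl⟩

end CoxeterGenerators

end FlatFibration

open FlatFibration

theorem theorem12 {n : ℕ} (Γ : Subgroup (FlatFibration.Isom n))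
    (hΓ : FlatFibration.IsSpaceGroup Γ) (N : Subgroup Γ) [N.Normal]
    (hN : FlatFibration.IsInfiniteDihedral (Γ ⧸ N))
    (hfin : Finite (FlatFibration.StructureGroup N))
    (γ₁ γ₂ : Γ)
    (hgen : Subgroup.closure {FlatFibration.toStructureGroup N γ₁,
      FlatFibration.toStructureGroup N γ₂} = ⊤) :
    (∃ δ₁ δ₂ : Γ,
        ({FlatFibration.toStructureGroup N γ₁, FlatFibration.toStructureGroup N γ₂} :
            Set (FlatFibration.StructureGroup N)) =
          {FlatFibration.toStructureGroup N δ₁, FlatFibration.toStructureGroup N δ₂} ∧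
        FlatFibration.IsCoxeterGenerators (δ₁ : Γ ⧸ N) (δ₂ : Γ ⧸ N)) ↔
      (Nat.card (FlatFibration.StructureGroup N) = 1 ∨
        (Nat.card (FlatFibration.StructureGroup N) = 2 ∧
          FlatFibration.IsInfiniteDihedral (FlatFibration.actionKernel N) ∧
          ((FlatFibration.toStructureGroup N γ₁ = 1 ∧
              FlatFibration.IsIntervalReflection (FlatFibration.perpOrbitMap N γ₂)) ∨
            (FlatFibration.toStructureGroup N γ₂ = 1 ∧
              FlatFibration.IsIntervalReflection (FlatFibration.perpOrbitMap N γ₁)))) ∨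
        (∃ m : ℕ, 0 < m ∧ Nat.card (FlatFibration.StructureGroup N) = 2 * m ∧
          FlatFibration.IsInfiniteCyclic (FlatFibration.actionKernel N) ∧
          FlatFibration.IsCircleReflection (FlatFibration.perpOrbitMap N γ₁) ∧
          FlatFibration.IsCircleReflection (FlatFibration.perpOrbitMap N γ₂) ∧
          (FlatFibration.IsCircleRotation (FlatFibration.perpOrbitMap N (γ₁ * γ₂))
              (2 * Real.pi / m) ∨
            FlatFibration.IsCircleRotation (FlatFibration.perpOrbitMap N (γ₁ * γ₂))
              (-(2 * Real.pi / m))))) := by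
  obtain ⟨e⟩ := hN
  obtain ⟨φ, a, ha, hφ⟩ := exists_line_coordinate N hΓ e
  let f : Γ →* DihedralGroup 0 := e.toMonoidHom.comp (QuotientGroup.mk' N)
  have hf : Function.Surjective f := e.surjective.comp (QuotientGroup.mk'_surjective N)
  have hcomap : ((actionKernel N).map f).comap f = N ⊔ actionKernel N :=
    comap_map_actionKernel N e
  have hindex : Nat.card (StructureGroup N) = ((actionKernel N).map f).index := by
    rw [← Subgroup.index_comap_of_surjective _ hf, hcomap]
    rfl
  have hone : ∀ γ, toStructureGroup N γ = 1 ↔ f γ ∈ (actionKernel N).map f := fun γ => by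
    rw [← Subgroup.mem_comap, hcomap]
    exact QuotientGroup.eq_one_iff γ
  rw [exists_coxeterGenerators_iff N e, hindex, hone, hone]
  refine isCoxeterPairMod_map_iff (perpAction N) (actionKernel N) f φ ha hf hφ
    ⟨hindex ▸ Nat.card_pos.ne'⟩ (fun κ hκ h => ?_) fun h1 h2 => ?_
  · refine eq_one_of_mem_actionKernel N hΓ e hκ ?_
    exact (QuotientGroup.eq_one_iff κ).1 ((map_eq_one_iff e e.injective).1 h)
  · rw [(hone γ₁).2 h1, (hone γ₂).2 h2, Set.pair_eq_singleton,
      Subgroup.closure_singleton_one] at hgen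
    rw [← Subgroup.index_eq_one, ← hindex, Nat.card_eq_one_iff_unique]
    have hsub : Subsingleton (StructureGroup N) := ⟨fun x y =>
      (Subgroup.mem_bot.1 (hgen ▸ Subgroup.mem_top x)).trans
        (Subgroup.mem_bot.1 (hgen ▸ Subgroup.mem_top y)).symm⟩
    exact ⟨hsub, ⟨1⟩⟩
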